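/- Let $m_1>m_2\ge 2$ and $q\ge 2$ be integers, $\mathcal A_i=\{0,\dots,m_i-1\}$, $\Sigma=(\mathcal A_1\times\mathcal A_2)^{\mathbb N^*}$, $\gamma=\log(m_2)/\log(m_1)$, and let $j\ge 0$ be the integer with $q^j\le 1/\gamma<q^{j+1}$. Equip $\Sigma$ with the metric $$d\big((x_k,y_k)_k,(u_k,v_k)_k\big)=\max\Big(m_1^{-\min\{k\ge 0:(x_{k+1},y_{k+1})\ne(u_{k+1},v_{k+1})\}},\ m_1^{-\gamma\min\{k\ge 0:y_{k+1}\ne v_{k+1}\}}\Big)$$ (with $\min\varnothing=\infty$ and $m_1^{-\infty}=0$), and let $\dim_H$ and $\dim_M$ be the Hausdorff and Minkowski (box-counting) dimensions for $d$. Let $\Omega\subset\Sigma$ be closed and non-empty, and let $$X_\Omega=\{(x_k,y_k)_{k\ge1}\in\Sigma:\ (x_{iq^\ell},y_{iq^\ell})_{\ell\ge 0}\in\Omega\ \text{ for all } i\ge1 \text{ with } q\nmid i\}.$$ For $p,\ell\ge 0$ let $\mathrm{Pref}_{p,\ell}(\Omega)$ be the set of words $(x_1,y_1)\cdots(x_p,y_p)\,y_{p+1}\cdots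 y_{p+\ell}$ obtained from the elements $(x_k,y_k)_{k\ge1}$ of $\Omega$. Let $\Gamma_j(\Omega)$ be the tree with root $\varnothing$ whose other vertices are the elements of $\mathrm{Pref}_{k,j}(\Omega)$, $k\ge1$, with edges from $\varnothing$ to every element of $\mathrm{Pref}_{1,j}(\Omega)$ and from $(x_1,y_1)\cdots(x_k,y_k)y_{k+1}\cdots y_{k+j}$ to every vertex of the form $(x_1,y_1)\cdots(x_{k+1},y_{k+1})y_{k+2}\cdots y_{k+j+1}$. A rooted tree is spherically symmetric if any two vertices at the same distance from the root have the same number of children. Consider the following four conditions: 1. the tree $\Gamma_j(\Omega)$ is spherically symmetric; 2. $\#\{x_1:(x_1,y_1)y_2\cdots y_{j+1}\in\mathrm{Pref}_{1,j}(\Omega)\}$ does not depend on $y_1\cdots y_{j+1}\in\mathrm{Pref}_{0,j+1}(\Omega)$; 3. for each $1\le p\le j$, $\#\{y_{p+1}:y_1\cdots y_{p+1}\in\mathrm{Pref}_{0,p+1}(\Omega)\}$ does not depend on $y_1\cdots y_p\in\mathrm{Pref}_{0,p}(\Omega)$; 4. for each $p\ge 2$, $\#\{x_p:(x_1,y_1)\cdots(x_p,y_p)y_{p+1}\cdots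 y_{p+j}\in\mathrm{Pref}_{p,j}(\Omega)\}$ does not depend on $(x_1,y_1)\cdots(x_{p-1},y_{p-1})y_p\cdots y_{p+j}\in\mathrm{Pref}_{p-1,j+1}(\Omega)$. Then $\dim_M(X_\Omega)$ exists, and the four conditions imply $\dim_M(X_\Omega)=\dim_H(X_\Omega)$. If moreover $q^j\ne 1/\gamma$ (that is, $m_1\ne m_2^{q^j}$), then $\dim_M(X_\Omega)=\dim_H(X_\Omega)$ if and only if the four conditions hold. -/

import Mathlib

open Set Filter Topology
open scoped NNReal ENNReal

noncomputable section

/-- The symbolic space `(A₁ × A₂)^{ℕ*}` with `Aᵢ = {0, …, mᵢ - 1}`. The letter of index `k ≥ 1` of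
the mathematical text is `letter (k - 1)`. -/
@[ext]
structure SymSeq (m₁ m₂ : ℕ) : Type where
  letter : ℕ → Fin m₁ × Fin m₂

/-- `γ = log m₂ / log m₁`. -/
def gammaRatio (m₁ m₂ : ℕ) : ℝ := Real.log m₂ / Real.log m₁

open scoped Classical in
/-- `b ^ (- c * n)`, where `n` is the number of letters of the longest common prefix of two
sequences `s` and `t`; it is `0` if the sequences are equal (so `n = ∞`). -/
def prefixDist {A : Type} (b c : ℝ) (s t : ℕ → A) : ℝ :=
  if s = t then 0 else b ^ (-(c * (PiNat.firstDiff (E := fun _ => A) s t : ℝ)))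

namespace SymSeq

variable {m₁ m₂ : ℕ}

/-- The projection to the second coordinate. -/
def snds (z : SymSeq m₁ m₂) : ℕ → Fin m₂ := fun k => (z.letter k).2

/-- The metric
`d (z, w) = max (m₁ ^ (- min {k ≥ 0 | z_{k+1} ≠ w_{k+1}}), m₁ ^ (- γ min {k ≥ 0 | y_{k+1} ≠ v_{k+1}}))`,
where `y`, `v` are the sequences of second coordinates of `z`, `w`. -/
def symDist (z w : SymSeq m₁ m₂) : ℝ :=
  max (prefixDist (m₁ : ℝ) 1 z.letter w.letter)
    (prefixDist (m₁ : ℝ) (gammaRatio m₁ m₂) z.snds w.snds)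

end SymSeq

theorem gammaRatio_nonneg (m₁ m₂ : ℕ) : 0 ≤ gammaRatio m₁ m₂ :=
  div_nonneg (Real.log_natCast_nonneg _) (Real.log_natCast_nonneg _)

theorem prefixDist_self {A : Type} (b c : ℝ) (s : ℕ → A) : prefixDist b c s s = 0 := by
  simp [prefixDist]

theorem prefixDist_comm {A : Type} (b c : ℝ) (s t : ℕ → A) :
    prefixDist b c s t = prefixDist b c t s := by
  by_cases h : s = t
  · rw [h]
  · simp only [prefixDist, h, Ne.symm h, if_false, PiNat.firstDiff_comm (E := fun _ => A) s t]

theorem prefixDist_nonneg {A : Type} {b : ℝ} (hb : 1 ≤ b) (c : ℝ) (s t : ℕ → A) :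
    0 ≤ prefixDist b c s t := by
  unfold prefixDist
  split_ifs
  · exact le_rfl
  · positivity

theorem prefixDist_triangle {A : Type} {b c : ℝ} (hb : 1 ≤ b) (hc : 0 ≤ c) (s t r : ℕ → A) :
    prefixDist b c s r ≤ max (prefixDist b c s t) (prefixDist b c t r) := by
  by_cases hst : s = t
  · subst hst; exact le_max_right _ _
  by_cases htr : t = r
  · subst htr; exact le_max_left _ _
  by_cases hsr : s = r
  · subst hsr
    rw [prefixDist_self]
    exact le_max_of_le_left (prefixDist_nonneg hb _ _ _)
  have h := PiNat.min_firstDiff_le (E := fun _ => A) s t r hsr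
  simp only [prefixDist, hst, htr, hsr, if_false]
  rcases min_le_iff.1 h with h | h
  · apply le_max_of_le_left
    apply Real.rpow_le_rpow_of_exponent_le hb
    gcongr
  · apply le_max_of_le_right
    apply Real.rpow_le_rpow_of_exponent_le hb
    gcongr

theorem SymSeq.one_le_left {m₁ m₂ : ℕ} (z : SymSeq m₁ m₂) : (1 : ℝ) ≤ m₁ := by
  exact_mod_cast Nat.one_le_iff_ne_zero.2 (fun h => by subst h; exact (z.letter 0).1.elim0)

instance SymSeq.instMetricSpace (m₁ m₂ : ℕ) : MetricSpace (SymSeq m₁ m₂) where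
  dist := SymSeq.symDist
  dist_self z := by
    show SymSeq.symDist z z = 0
    unfold SymSeq.symDist
    rw [prefixDist_self, prefixDist_self, max_self]
  dist_comm z w := by
    show SymSeq.symDist z w = SymSeq.symDist w z
    exact congrArg₂ max (prefixDist_comm _ _ _ _) (prefixDist_comm _ _ _ _)
  dist_triangle z w v := by
    show SymSeq.symDist z v ≤ SymSeq.symDist z w + SymSeq.symDist w v
    have hb := z.one_le_left
    have h0 : ∀ a c : SymSeq m₁ m₂, 0 ≤ SymSeq.symDist a c := fun a c =>
      le_max_of_le_left (prefixDist_nonneg hb _ _ _)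
    refine le_trans ?_ (max_le_add_of_nonneg (h0 z w) (h0 w v))
    refine max_le ?_ ?_
    · exact (prefixDist_triangle hb zero_le_one _ w.letter _).trans
        (max_le_max (le_max_left _ _) (le_max_left _ _))
    · exact (prefixDist_triangle hb (gammaRatio_nonneg m₁ m₂) _ w.snds _).trans
        (max_le_max (le_max_right _ _) (le_max_right _ _))
  eq_of_dist_eq_zero := by
    intro z w h
    change SymSeq.symDist z w = 0 at h
    by_contra hne
    have hb := z.one_le_left
    have h1 : prefixDist (m₁ : ℝ) 1 z.letter w.letter ≤ 0 :=
      (le_max_left _ _).trans h.le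
    have hne' : ¬ (z.letter = w.letter) := fun h' => hne (SymSeq.ext h')
    unfold prefixDist at h1
    rw [if_neg hne'] at h1
    exact absurd h1 (not_le.2 (Real.rpow_pos_of_pos (by linarith) _))

/-- A totally bounded set `S` has Minkowski (box-counting) dimension `D` if
`log N(ε, S) / log (1 / ε) → D` as `ε → 0⁺`, where `N(ε, S)` is the minimal number of balls of
radius `ε` needed to cover `S`. -/
def HasMinkowskiDim {E : Type*} [PseudoMetricSpace E] (S : Set E) (D : ℝ) : Prop :=
  TotallyBounded S ∧
    Tendsto (fun ε : ℝ≥0 => Real.log ((Metric.coveringNumber ε S).toNat : ℝ) / Real.log (1 / (ε : ℝ)))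
      (𝓝[>] 0) (𝓝 D)

/-- `X_Ω = {z | (z_{i q^ℓ})_{ℓ ≥ 0} ∈ Ω for all i with q ∤ i}` (for indices starting at `1`). -/
def multInvSet {m₁ m₂ : ℕ} (q : ℕ) (Ω : Set (SymSeq m₁ m₂)) : Set (SymSeq m₁ m₂) :=
  {z | ∀ i : ℕ, ¬ q ∣ i → (⟨fun l => z.letter (i * q ^ l - 1)⟩ : SymSeq m₁ m₂) ∈ Ω}

/-- Words `(x₁,y₁) ⋯ (x_p,y_p) y_{p+1} ⋯ y_{p+ℓ}`, as pairs of lists. -/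
abbrev GenWord (m₁ m₂ : ℕ) : Type := List (Fin m₁ × Fin m₂) × List (Fin m₂)

/-- The generalized cylinder `[u]`. -/
def genCylinder {m₁ m₂ : ℕ} (u : GenWord m₁ m₂) : Set (SymSeq m₁ m₂) :=
  {z | (List.range u.1.length).map (fun k => z.letter k) = u.1 ∧
    (List.range u.2.length).map (fun k => (z.letter (u.1.length + k)).2) = u.2}

/-- `Pref_{p,ℓ}(Ω)`: the words `u` of size `(p, ℓ)` with `Ω ∩ [u] ≠ ∅`. -/
def pref {m₁ m₂ : ℕ} (Ω : Set (SymSeq m₁ m₂)) (p l : ℕ) : Set (GenWord m₁ m₂) :=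
  {u | u.1.length = p ∧ u.2.length = l ∧ (Ω ∩ genCylinder u).Nonempty}

/-- The vertices of the `j`-th tree of prefixes: the root `∅` (the empty word) and the elements of
`Pref_{k,j}(Ω)` for `k ≥ 1`. -/
def prefixTreeVertices {m₁ m₂ : ℕ} (Ω : Set (SymSeq m₁ m₂)) (j : ℕ) : Set (GenWord m₁ m₂) :=
  {([], [])} ∪ ⋃ k ≥ 1, pref Ω k j

/-- `v` is obtained from `u = (x₁,y₁) ⋯ (x_k,y_k) y_{k+1} ⋯ y_{k+j}` by appending a letter
`y_{k+j+1}` and then turning `y_{k+1}` into a pair `(x_{k+1}, y_{k+1})`. -/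
def IsWordStep {m₁ m₂ : ℕ} (u v : GenWord m₁ m₂) : Prop :=
  ∃ (x : Fin m₁) (y : Fin m₂) (y' : Fin m₂) (ys : List (Fin m₂)),
    u.2 ++ [y'] = y :: ys ∧ v = (u.1 ++ [(x, y)], ys)

/-- The `j`-th tree of prefixes `Γ_j(Ω)`: edges go from the root to all `u ∈ Pref_{1,j}(Ω)`, and from
`u ∈ Pref_{k,j}(Ω)`, `k ≥ 1`, to the vertices that are obtained from `u` by one step. -/
def prefixTree {m₁ m₂ : ℕ} (Ω : Set (SymSeq m₁ m₂)) (j : ℕ) :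
    Digraph (prefixTreeVertices Ω j) where
  Adj u v := (u.1 = ([], []) ∧ v.1 ∈ pref Ω 1 j) ∨
    (∃ k ≥ 1, u.1 ∈ pref Ω k j ∧ v.1 ∈ pref Ω (k + 1) j ∧ IsWordStep u.1 v.1)

/-- The root `∅` of the tree of prefixes. -/
def prefixTreeRoot {m₁ m₂ : ℕ} (Ω : Set (SymSeq m₁ m₂)) (j : ℕ) : prefixTreeVertices Ω j :=
  ⟨([], []), Or.inl rfl⟩

/-- The set of vertices that are reached from `r` by a directed path with `n` edges. -/
def Digraph.levelSet {V : Type*} (G : Digraph V) (r : V) : ℕ → Set V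
  | 0 => {r}
  | n + 1 => {w | ∃ v ∈ Digraph.levelSet G r n, G.Adj v w}

/-- A tree with root `r` and edges directed away from the root is spherically symmetric if all
vertices at the same distance from the root have the same number of children. -/
def Digraph.IsSphericallySymmetric {V : Type*} (G : Digraph V) (r : V) : Prop :=
  ∀ n : ℕ, ∀ v ∈ G.levelSet r n, ∀ w ∈ G.levelSet r n,
    {a | G.Adj v a}.encard = {a | G.Adj w a}.encard

/-- The four conditions on `Ω`: spherical symmetry of `Γ_j(Ω)` and the three conditions on the
numbers of followers. -/
structure HasUniformFollowers {m₁ m₂ : ℕ} (Ω : Set (SymSeq m₁ m₂)) (j : ℕ) : Prop where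
  symmetric : (prefixTree Ω j).IsSphericallySymmetric (prefixTreeRoot Ω j)
  /-- `#{x₁ | (x₁,y₁) y₂ ⋯ y_{j+1} ∈ Pref_{1,j}(Ω)}` does not depend on
  `y₁ ⋯ y_{j+1} ∈ Pref_{0,j+1}(Ω)`. -/
  first_x : ∃ N : ℕ, ∀ (y : Fin m₂) (ys : List (Fin m₂)),
    (([], y :: ys) : GenWord m₁ m₂) ∈ pref Ω 0 (j + 1) →
      {x : Fin m₁ | ([(x, y)], ys) ∈ pref Ω 1 j}.ncard = N
  /-- For `1 ≤ p ≤ j`, `#{y_{p+1} | y₁ ⋯ y_{p+1} ∈ Pref_{0,p+1}(Ω)}` does not depend on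
  `y₁ ⋯ y_p ∈ Pref_{0,p}(Ω)`. -/
  next_y : ∀ p : ℕ, 1 ≤ p → p ≤ j → ∃ N : ℕ, ∀ ys : List (Fin m₂),
    (([], ys) : GenWord m₁ m₂) ∈ pref Ω 0 p →
      {y : Fin m₂ | (([], ys ++ [y]) : GenWord m₁ m₂) ∈ pref Ω 0 (p + 1)}.ncard = N
  /-- For `p ≥ 2`, `#{x_p | (x₁,y₁) ⋯ (x_p,y_p) y_{p+1} ⋯ y_{p+j} ∈ Pref_{p,j}(Ω)}` does not depend
  on `(x₁,y₁) ⋯ (x_{p-1},y_{p-1}) y_p ⋯ y_{p+j} ∈ Pref_{p-1,j+1}(Ω)`. -/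
  next_x : ∀ p : ℕ, 2 ≤ p → ∃ N : ℕ,
    ∀ (w : List (Fin m₁ × Fin m₂)) (y : Fin m₂) (ys : List (Fin m₂)),
      (w, y :: ys) ∈ pref Ω (p - 1) (j + 1) →
        {x : Fin m₁ | (w ++ [(x, y)], ys) ∈ pref Ω p j}.ncard = N

end

/-! Every positive integer is uniquely `i * q ^ l` with `¬ q ∣ i`, so `X_Ω` is a product of
independent copies of `Ω`, one for each such `i`. A ball of radius `m₁ ^ (-n)` fixes `n` letters and
`L = ⌈n / γ⌉` second coordinates. On the orbit of `i` it fixes a word of size `(p, P - p)`, where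
`p` and `P` count the orbit elements up to `n` and up to `L`. Hence the number `N n` of such balls
meeting `X_Ω` is a product of cardinalities of sets `Pref` (`squareCount`,
`coveringNumber_multInvSet`). Each class `(p, P)` has a density among the `i`, and dominated
convergence gives `log (N n) / n → h`. So the Minkowski dimension is `h / log m₁`.

The choice of `j` forces `P - p ∈ {j, j + 1}` if `p ≥ 1`, and `P ≤ j + 1` if `p = 0`. The four
conditions say that any two words of the same occurring size have equally many extensions to a large
common size. Uniform counting then gives each ball of radius `m₁ ^ (-n)` mass exactly `1 / N n`
(`one_le_sum_inv_squareCount`), and the mass distribution principle yields equality of the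
dimensions.

Conversely, suppose that a size `a` is not uniformly refined by a larger size `b`. Then some
cylinder `V` of size `a` has different proportions `ρ a ≠ ρ b` among the words of the two sizes.
Multiply the uniform weights of words of sizes `a` and `b` by factors of mean one that depend only
on membership in `V`. Averaged over scales with weight `1 / (n (n + 1))`, an orbit contributes `κ
log(..) + κ' log(..)` to the logarithm of the product, up to a factor `1 / i`. The tilts can be
chosen to make this positive whether or not the orbit starts in `V` (`exists_tilt_pos`). So each
point of `X_Ω` has, at infinitely many scales, tilted density at least `exp (δ n)`. By Markov's
inequality, `N n * exp (-δ n)` balls cover such points, and the Hausdorff dimension drops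
(`dimH_lt_of_not_uniformlyRefines`). The averages need classes of positive logarithmic density,
which is where `q ^ j ≠ 1 / γ` enters. -/

/-! ### Uniform refinement of one map by another on a set. -/

section UniformRefinement

variable {S A B C : Type*}

/-- On `Ω`, every value of `f` is refined by the same number of values of `g`. -/
def UniformlyRefines (Ω : Set S) (f : S → A) (g : S → B) : Prop :=
  ∃ N : ℕ, ∀ s ∈ Ω, (g '' {t ∈ Ω | f t = f s}).ncard = N

/-- Group the `h`-values over an `f`-fibre by the `g`-value they determine. Since `f` is determined
by `g`, each `g`-fibre that meets the `f`-fibre lies inside it, so each group has exactly `N`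
elements. -/
theorem ncard_image_refine_trans {Ω : Set S} {f : S → A} {g : S → B} {h : S → C}
    (hfg : f.FactorsThrough g) (hgh : g.FactorsThrough h) (hfin : (h '' Ω).Finite)
    {N : ℕ} (hN : ∀ s ∈ Ω, (h '' {t ∈ Ω | g t = g s}).ncard = N) (s : S) :
    (h '' {t ∈ Ω | f t = f s}).ncard = (g '' {t ∈ Ω | f t = f s}).ncard * N := by
  classical
  have hfin' : ∀ P : S → Prop, (h '' {t ∈ Ω | P t}).Finite := fun P =>
    hfin.subset (image_mono fun t ht => ht.1)
  obtain ⟨k, hk⟩ : ∃ k : C → B, ∀ t, k (h t) = g t := by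
    have : Nonempty B := ⟨g s⟩
    exact ⟨Function.extend h g fun _ => g s, fun t => hgh.extend_apply _ t⟩
  have himg : g '' {t ∈ Ω | f t = f s} = k '' (h '' {t ∈ Ω | f t = f s}) := by
    rw [image_image]; exact image_congr fun t _ => (hk t).symm
  have hF := hfin' fun t => f t = f s
  have e1 : (h '' {t ∈ Ω | f t = f s}).ncard = hF.toFinset.card :=
    ncard_eq_toFinset_card _ hF
  have e2 : (g '' {t ∈ Ω | f t = f s}).ncard = (hF.toFinset.image k).card := by
    rw [himg, ← ncard_coe_finset]; congr 1; ext; simp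
  rw [e1, e2, Finset.card_eq_sum_card_image k, Finset.sum_const_nat (m := N)]
  intro b hb
  obtain ⟨c, hc, rfl⟩ := Finset.mem_image.1 hb
  obtain ⟨t, ht, rfl⟩ := (hF.mem_toFinset).1 hc
  rw [← hN t ht.1, ← ncard_coe_finset]
  congr 1
  ext c
  simp only [Finset.coe_filter, Finite.mem_toFinset, mem_ofPred_eq, mem_image, hk]
  constructor
  · rintro ⟨⟨t', ht', rfl⟩, h'⟩
    exact ⟨t', ⟨ht'.1, by rw [← hk t', h']⟩, rfl⟩
  · rintro ⟨t', ht', rfl⟩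
    exact ⟨⟨t', ⟨ht'.1, by rw [hfg ht'.2, ht.2]⟩, rfl⟩, by rw [hk, ht'.2]⟩

theorem UniformlyRefines.trans {Ω : Set S} {f : S → A} {g : S → B} {h : S → C}
    (hfg : f.FactorsThrough g) (hgh : g.FactorsThrough h) (hfin : (h '' Ω).Finite)
    (h₁ : UniformlyRefines Ω f g) (h₂ : UniformlyRefines Ω g h) : UniformlyRefines Ω f h := by
  obtain ⟨N₁, h₁⟩ := h₁
  obtain ⟨N₂, h₂⟩ := h₂
  exact ⟨N₁ * N₂, fun s hs => by rw [ncard_image_refine_trans hfg hgh hfin h₂, h₁ s hs]⟩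

theorem UniformlyRefines.refl (Ω : Set S) (f : S → A) : UniformlyRefines Ω f f := by
  refine ⟨1, fun s hs => ?_⟩
  rw [ncard_eq_one]
  refine ⟨f s, ?_⟩
  ext a
  constructor
  · rintro ⟨t, ht, rfl⟩; exact ht.2
  · rintro rfl; exact ⟨s, ⟨hs, rfl⟩, rfl⟩

theorem UniformlyRefines.ncard_mul {Ω : Set S} {f : S → A} {g : S → B}
    (hfg : f.FactorsThrough g) (hfin : (g '' Ω).Finite) (h : UniformlyRefines Ω f g) {s : S}
    (hs : s ∈ Ω) :
    (g '' {t ∈ Ω | f t = f s}).ncard * (f '' Ω).ncard = (g '' Ω).ncard := by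
  obtain ⟨N, hN⟩ := h
  -- A constant map has the single fibre `Ω`, so the product formula counts all of `g '' Ω`.
  have := ncard_image_refine_trans (f := fun _ => ()) (fun _ _ _ => rfl) hfg hfin hN s
  simp only [and_true, ofPred_mem_eq] at this
  rw [this, hN s hs, mul_comm]

/-- Used in contrapositive form: without uniformity, some fibre of `f` has different proportions
among the values of `f` and of `g`. -/
theorem uniformlyRefines_of_ncard_mul {Ω : Set S} {f : S → A} {g : S → B}
    (hfin : (f '' Ω).Finite)
    (h : ∀ s ∈ Ω, (g '' {t ∈ Ω | f t = f s}).ncard * (f '' Ω).ncard = (g '' Ω).ncard) :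
    UniformlyRefines Ω f g := by
  rcases Ω.eq_empty_or_nonempty with rfl | ⟨s₀, hs₀⟩
  · exact ⟨0, fun s hs => hs.elim⟩
  have hpos : 0 < (f '' Ω).ncard := (ncard_pos hfin).2 ⟨_, mem_image_of_mem f hs₀⟩
  exact ⟨_, fun s hs => Nat.eq_of_mul_eq_mul_right hpos ((h s hs).trans (h s₀ hs₀).symm)⟩

end UniformRefinement

/-! ### Words of a sequence and generalized prefixes. -/

namespace SymSeq

variable {m₁ m₂ : ℕ}

/-- The word `(x₁,y₁) ⋯ (x_p,y_p) y_{p+1} ⋯ y_{p+l}` of a sequence. -/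
def word (p l : ℕ) (s : SymSeq m₁ m₂) : GenWord m₁ m₂ :=
  ((List.range p).map s.letter, (List.range l).map fun k => (s.letter (p + k)).2)

theorem word_eq_iff {p l : ℕ} {s t : SymSeq m₁ m₂} :
    s.word p l = t.word p l ↔
      (∀ k < p, s.letter k = t.letter k) ∧ ∀ k < p + l, (s.letter k).2 = (t.letter k).2 := by
  simp only [word, Prod.mk.injEq, List.map_inj_left, List.mem_range]
  refine and_congr_right fun h => ⟨fun h' k hk => ?_, fun h' k hk => h' _ (by omega)⟩
  rcases lt_or_ge k p with hp | hp
  · rw [h k hp]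
  · have := h' (k - p) (by omega)
    rwa [Nat.add_sub_cancel' hp] at this

/-- The two inequalities are the partial order on word sizes for which cylinders are nested. -/
theorem word_factorsThrough {p l p' l' : ℕ} (h : p ≤ p') (h' : p + l ≤ p' + l') :
    (word p l : SymSeq m₁ m₂ → _).FactorsThrough (word p' l') := by
  intro s t hst
  rw [word_eq_iff] at hst ⊢
  exact ⟨fun k hk => hst.1 k (by omega), fun k hk => hst.2 k (by omega)⟩

theorem mem_genCylinder_iff {p l : ℕ} {u : GenWord m₁ m₂} (h₁ : u.1.length = p)
    (h₂ : u.2.length = l) (s : SymSeq m₁ m₂) : s ∈ genCylinder u ↔ s.word p l = u := by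
  subst h₁ h₂
  simp [genCylinder, word, Prod.ext_iff]

/-- This turns conditions on extensions of words into statements about fibres of the maps `word p l`
on `Ω`. -/
theorem pref_eq_image (Ω : Set (SymSeq m₁ m₂)) (p l : ℕ) : pref Ω p l = word p l '' Ω := by
  ext u
  constructor
  · rintro ⟨h₁, h₂, s, hs, hu⟩
    exact ⟨s, hs, (mem_genCylinder_iff h₁ h₂ s).1 hu⟩
  · rintro ⟨s, hs, rfl⟩
    refine ⟨by simp [word], by simp [word], s, hs, ?_⟩
    rw [mem_genCylinder_iff (p := p) (l := l)] <;> simp [word]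

theorem finite_pref (Ω : Set (SymSeq m₁ m₂)) (p l : ℕ) : (pref Ω p l).Finite :=
  ((List.finite_length_eq (Fin m₁ × Fin m₂) p).prod (List.finite_length_eq (Fin m₂) l)).subset
    fun _ hu => ⟨hu.1, hu.2.1⟩

theorem finite_image_word (Ω : Set (SymSeq m₁ m₂)) (p l : ℕ) : (word p l '' Ω).Finite :=
  pref_eq_image Ω p l ▸ finite_pref Ω p l

theorem ncard_pref_le (Ω : Set (SymSeq m₁ m₂)) (p l : ℕ) :
    (pref Ω p l).ncard ≤ (m₁ * m₂) ^ p * m₂ ^ l := by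
  have h : pref Ω p l ⊆ {u : List (Fin m₁ × Fin m₂) | u.length = p} ×ˢ
      {u : List (Fin m₂) | u.length = l} := fun _ hu => ⟨hu.1, hu.2.1⟩
  have hf := (List.finite_length_eq (Fin m₁ × Fin m₂) p).prod (List.finite_length_eq (Fin m₂) l)
  refine (ncard_le_ncard h hf).trans ?_
  rw [ncard_prod]
  have key : ∀ (α : Type) [Fintype α] (n : ℕ),
      {u : List α | u.length = n}.ncard = Fintype.card α ^ n := by
    intro α _ n
    rw [← card_vector (α := α) n, ← Nat.card_eq_fintype_card]
    exact Nat.card_congr (Equiv.subtypeEquivRight fun _ => Iff.rfl)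
  rw [key, key]
  simp

/-- Both sides are the second list of the word of size `(p, l + 1)`, split off at its end or at its
start. -/
theorem word_succ_snd (s : SymSeq m₁ m₂) (p l : ℕ) :
    (s.word p l).2 ++ [(s.letter (p + l)).2] =
      (s.letter p).2 :: (s.word (p + 1) l).2 := by
  have h : (s.word p (l + 1)).2 = (s.word p l).2 ++ [(s.letter (p + l)).2] := by
    simp [word, List.range_succ]
  have h' : (s.word p (l + 1)).2 = (s.letter p).2 :: (s.word (p + 1) l).2 := by
    simp only [word, List.range_succ_eq_map, List.map_cons, List.map_map, add_zero,
      List.cons.injEq, true_and]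
    refine List.map_congr_left fun k _ => ?_
    simp [Nat.add_assoc, Nat.add_comm 1]
  rw [← h, h']

theorem word_succ_fst (s : SymSeq m₁ m₂) (p l : ℕ) :
    (s.word (p + 1) l).1 = (s.word p l).1 ++ [s.letter p] := by
  simp [word, List.range_succ]

theorem isWordStep_word_iff {s t : SymSeq m₁ m₂} {p l : ℕ} :
    IsWordStep (s.word p l) (t.word (p + 1) l) ↔ t.word p l = s.word p l := by
  constructor
  · rintro ⟨x, y, y', ys, h₁, h₂⟩
    rw [Prod.ext_iff] at h₂
    obtain ⟨h₂, h₃⟩ := h₂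
    dsimp only at h₂ h₃
    rw [word_succ_fst] at h₂
    obtain ⟨h₄, h₅⟩ := List.append_inj' h₂ rfl
    have h₆ := word_succ_snd t p l
    rw [h₃, List.singleton_inj.1 h₅, ← h₁] at h₆
    exact Prod.ext h₄ (List.append_inj' h₆ rfl).1
  · intro h
    refine ⟨(t.letter p).1, (t.letter p).2, (t.letter (p + l)).2,
      (t.word (p + 1) l).2, ?_, ?_⟩
    · rw [← h, word_succ_snd]
    · rw [← h]
      exact Prod.ext (word_succ_fst t p l) rfl

end SymSeq

open SymSeq

/-! ### The four conditions as uniform refinements. -/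

section Tree

variable {m₁ m₂ : ℕ} {Ω : Set (SymSeq m₁ m₂)} {j : ℕ}

theorem word_mem_prefixTreeVertices {s : SymSeq m₁ m₂} (hs : s ∈ Ω) {k : ℕ} (hk : 1 ≤ k) :
    s.word k j ∈ prefixTreeVertices Ω j := by
  refine Or.inr (mem_iUnion₂.2 ⟨k, hk, ?_⟩)
  rw [pref_eq_image]
  exact mem_image_of_mem _ hs

/-- No prefix is missed: a sequence of `Ω` that witnesses a vertex also witnesses its parent.
Lengths identify the level on which a vertex lies. -/
theorem levelSet_prefixTree (n : ℕ) (v : prefixTreeVertices Ω j) :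
    v ∈ (prefixTree Ω j).levelSet (prefixTreeRoot Ω j) (n + 1) ↔ v.1 ∈ pref Ω (n + 1) j := by
  induction n generalizing v with
  | zero =>
    constructor
    · rintro ⟨u, rfl, h | ⟨k, hk, h, -⟩⟩
      · exact h.2
      · have := h.1
        simp [prefixTreeRoot] at this
        omega
    · exact fun h => ⟨_, rfl, Or.inl ⟨rfl, h⟩⟩
  | succ n ih =>
    constructor
    · rintro ⟨u, hu, h | ⟨k, hk, h, h', -⟩⟩
      · have := ((ih u).1 hu).1
        rw [h.1] at this
        simp at this
      · have h₁ := ((ih u).1 hu).1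
        rw [h.1] at h₁
        rwa [h₁] at h'
    · intro h
      rw [pref_eq_image] at h
      obtain ⟨s, hs, hv⟩ := h
      have hm : s.word (n + 1) j ∈ pref Ω (n + 1) j := by
        rw [pref_eq_image]; exact mem_image_of_mem _ hs
      refine ⟨⟨_, word_mem_prefixTreeVertices hs (k := n + 1) (by omega)⟩, (ih _).2 hm,
        Or.inr ⟨n + 1, by omega, hm, ?_, ?_⟩⟩
      · rw [← hv, pref_eq_image]; exact mem_image_of_mem _ hs
      · rw [← hv]; exact isWordStep_word_iff.2 rfl

theorem encard_children_prefixTree {s : SymSeq m₁ m₂} (hs : s ∈ Ω) {k : ℕ} (hk : 1 ≤ k)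
    (v : prefixTreeVertices Ω j) (hv : v.1 = s.word k j) :
    {a | (prefixTree Ω j).Adj v a}.encard =
      ((word (k + 1) j '' {t ∈ Ω | t.word k j = s.word k j}).ncard : ℕ∞) := by
  have hfin : (word (k + 1) j '' {t ∈ Ω | t.word k j = s.word k j}).Finite :=
    (finite_image_word Ω (k + 1) j).subset (image_mono fun t ht => ht.1)
  rw [hfin.cast_ncard_eq, ← (Subtype.val_injective).encard_image]
  congr 1
  have hlen : v.1.1.length = k := by rw [hv]; simp [word]
  ext w
  constructor
  · rintro ⟨a, h | ⟨k', hk', h, h', hst⟩, rfl⟩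
    · rw [h.1] at hlen; simp at hlen; omega
    · obtain rfl : k' = k := by rw [← h.1, hlen]
      rw [pref_eq_image] at h'
      obtain ⟨t, ht, hta⟩ := h'
      rw [← hta, hv, isWordStep_word_iff] at hst
      exact ⟨t, ⟨ht, hst⟩, hta⟩
  · rintro ⟨t, ⟨ht, hts⟩, rfl⟩
    refine ⟨⟨_, word_mem_prefixTreeVertices ht (k := k + 1) (by omega)⟩,
      Or.inr ⟨k, hk, ?_, ?_, ?_⟩, rfl⟩
    · rw [hv, pref_eq_image]; exact mem_image_of_mem _ hs
    · rw [pref_eq_image]; exact mem_image_of_mem _ ht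
    · rw [hv]; exact isWordStep_word_iff.2 hts

/-- The root is alone on its level and imposes nothing, hence `k ≥ 1`. -/
theorem prefixTree_isSphericallySymmetric_iff :
    (prefixTree Ω j).IsSphericallySymmetric (prefixTreeRoot Ω j) ↔
      ∀ k ≥ 1, UniformlyRefines Ω (word k j) (word (k + 1) j) := by
  constructor
  · intro h k hk
    rcases Ω.eq_empty_or_nonempty with rfl | ⟨s₀, hs₀⟩
    · exact ⟨0, fun s hs => hs.elim⟩
    refine ⟨(word (k + 1) j '' {t ∈ Ω | t.word k j = s₀.word k j}).ncard, fun s hs => ?_⟩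
    obtain ⟨n, rfl⟩ := Nat.exists_eq_add_of_le' hk
    have hm : ∀ s ∈ Ω, s.word (n + 1) j ∈ pref Ω (n + 1) j := fun s hs => by
      rw [pref_eq_image]; exact mem_image_of_mem _ hs
    have := h (n + 1) ⟨_, word_mem_prefixTreeVertices hs hk⟩
      ((levelSet_prefixTree n _).2 (hm s hs)) ⟨_, word_mem_prefixTreeVertices hs₀ hk⟩
      ((levelSet_prefixTree n _).2 (hm s₀ hs₀))
    rw [encard_children_prefixTree hs hk _ rfl, encard_children_prefixTree hs₀ hk _ rfl] at this
    exact_mod_cast this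
  · rintro h (_ | n) v hv w hw
    · rw [show v = w from (hv : v = _).trans (hw : w = _).symm]
    · rw [levelSet_prefixTree, pref_eq_image] at hv hw
      obtain ⟨s, hs, hv⟩ := hv
      obtain ⟨t, ht, hw⟩ := hw
      obtain ⟨N, hN⟩ := h (n + 1) (by omega)
      rw [encard_children_prefixTree hs (k := n + 1) (by omega) v hv.symm,
        encard_children_prefixTree ht (k := n + 1) (by omega) w hw.symm, hN s hs, hN t ht]

/-- With `w` and `y :: ys` fixed, the extended word is an injective function of `x`. The case `p =
0` is the second condition, and `p + 1` in place of `p` gives the fourth. -/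
theorem exists_ncard_next_x_iff (p : ℕ) :
    (∃ N : ℕ, ∀ (w : List (Fin m₁ × Fin m₂)) (y : Fin m₂) (ys : List (Fin m₂)),
      (w, y :: ys) ∈ pref Ω p (j + 1) →
        {x : Fin m₁ | (w ++ [(x, y)], ys) ∈ pref Ω (p + 1) j}.ncard = N) ↔
      UniformlyRefines Ω (word p (j + 1)) (word (p + 1) j) := by
  have key : ∀ s ∈ Ω, ∀ w y ys, s.word p (j + 1) = (w, y :: ys) →
      {x : Fin m₁ | (w ++ [(x, y)], ys) ∈ pref Ω (p + 1) j}.ncard =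
        (word (p + 1) j '' {t ∈ Ω | t.word p (j + 1) = s.word p (j + 1)}).ncard := by
    intro s hs w y ys h
    have hw1 : ∀ t : SymSeq m₁ m₂, t.word p (j + 1) =
        ((t.word p j).1, (t.letter p).2 :: (t.word (p + 1) j).2) := by
      intro t
      rw [← word_succ_snd]
      simp [word, List.range_succ]
    have hinj : Function.Injective fun x : Fin m₁ => (w ++ [(x, y)], ys) := by
      intro x x' hx
      simpa using hx
    rw [← ncard_image_of_injective _ hinj, h, pref_eq_image]
    congr 1
    ext u
    simp only [mem_image, mem_ofPred_eq]
    constructor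
    · rintro ⟨x, ⟨t, ht, htx⟩, rfl⟩
      refine ⟨t, ⟨ht, ?_⟩, htx⟩
      rw [Prod.ext_iff, word_succ_fst] at htx
      obtain ⟨h₄, h₅⟩ := List.append_inj' htx.1 rfl
      rw [hw1, h₄, List.singleton_inj.1 h₅, htx.2]
    · rintro ⟨t, ⟨ht, htx⟩, rfl⟩
      rw [hw1] at htx
      simp only [Prod.mk.injEq, List.cons.injEq] at htx
      have : (w ++ [((t.letter p).1, y)], ys) = t.word (p + 1) j :=
        Prod.ext (by rw [word_succ_fst, htx.1, ← htx.2.1]) htx.2.2.symm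
      exact ⟨(t.letter p).1, ⟨t, ht, this.symm⟩, this⟩
  constructor
  · rintro ⟨N, hN⟩
    refine ⟨N, fun s hs => ?_⟩
    obtain ⟨w, y, ys, h⟩ : ∃ w y ys, s.word p (j + 1) = (w, y :: ys) :=
      ⟨_, _, _, by simp only [word, List.range_succ_eq_map, List.map_cons]; rfl⟩
    rw [← key s hs w y ys h]
    apply hN
    rw [pref_eq_image]
    exact ⟨s, hs, h⟩
  · rintro ⟨N, hN⟩
    refine ⟨N, fun w y ys h => ?_⟩
    rw [pref_eq_image] at h
    obtain ⟨s, hs, h⟩ := h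
    rw [key s hs w y ys h, hN s hs]

theorem exists_ncard_next_y_iff (p : ℕ) :
    (∃ N : ℕ, ∀ ys : List (Fin m₂), (([], ys) : GenWord m₁ m₂) ∈ pref Ω 0 p →
      {y : Fin m₂ | (([], ys ++ [y]) : GenWord m₁ m₂) ∈ pref Ω 0 (p + 1)}.ncard = N) ↔
      UniformlyRefines Ω (word 0 p) (word 0 (p + 1)) := by
  have hsucc : ∀ t : SymSeq m₁ m₂, t.word 0 (p + 1) =
      ([], (t.word 0 p).2 ++ [(t.letter p).2]) := by
    intro t
    simp [word, List.range_succ]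
  have hz : ∀ t : SymSeq m₁ m₂, t.word 0 p = ([], (t.word 0 p).2) := fun t => by simp [word]
  have key : ∀ s ∈ Ω, ∀ ys, s.word 0 p = ([], ys) →
      {y : Fin m₂ | (([], ys ++ [y]) : GenWord m₁ m₂) ∈ pref Ω 0 (p + 1)}.ncard =
        (word 0 (p + 1) '' {t ∈ Ω | t.word 0 p = s.word 0 p}).ncard := by
    intro s hs ys h
    have hinj : Function.Injective fun y : Fin m₂ => (([], ys ++ [y]) : GenWord m₁ m₂) := by
      intro x x' hx
      simpa using hx
    rw [← ncard_image_of_injective _ hinj, h, pref_eq_image]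
    congr 1
    ext u
    simp only [mem_image, mem_ofPred_eq]
    constructor
    · rintro ⟨x, ⟨t, ht, htx⟩, rfl⟩
      refine ⟨t, ⟨ht, ?_⟩, htx⟩
      rw [hsucc] at htx
      rw [hz, (List.append_inj' (Prod.ext_iff.1 htx).2 rfl).1]
    · rintro ⟨t, ⟨ht, htx⟩, rfl⟩
      have : (([], ys ++ [(t.letter p).2]) : GenWord m₁ m₂) = t.word 0 (p + 1) := by
        rw [hsucc, htx]
      exact ⟨_, ⟨t, ht, this.symm⟩, this⟩
  constructor
  · rintro ⟨N, hN⟩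
    refine ⟨N, fun s hs => ?_⟩
    rw [← key s hs _ (hz s)]
    apply hN
    rw [pref_eq_image]
    exact ⟨s, hs, hz s⟩
  · rintro ⟨N, hN⟩
    refine ⟨N, fun ys h => ?_⟩
    rw [pref_eq_image] at h
    obtain ⟨s, hs, h⟩ := h
    rw [key s hs ys h, hN s hs]

theorem hasUniformFollowers_iff : HasUniformFollowers Ω j ↔
    (∀ k ≥ 1, UniformlyRefines Ω (word k j) (word (k + 1) j)) ∧
    (∀ p, 1 ≤ p → p ≤ j → UniformlyRefines Ω (word 0 p) (word 0 (p + 1))) ∧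
    ∀ p, UniformlyRefines Ω (word p (j + 1)) (word (p + 1) j) := by
  have h0 := exists_ncard_next_x_iff (Ω := Ω) (j := j) 0
  constructor
  · rintro ⟨h₁, h₂, h₃, h₄⟩
    refine ⟨prefixTree_isSphericallySymmetric_iff.1 h₁, fun p hp hp' =>
      (exists_ncard_next_y_iff p).1 (h₃ p hp hp'), ?_⟩
    rintro (_ | p)
    · refine h0.1 ?_
      obtain ⟨N, hN⟩ := h₂
      refine ⟨N, fun w y ys h => ?_⟩
      obtain rfl : w = [] := List.length_eq_zero_iff.1 h.1
      exact hN y ys h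
    · exact (exists_ncard_next_x_iff _).1 (h₄ (p + 2) (by omega))
  · rintro ⟨h₁, h₂, h₃⟩
    refine ⟨prefixTree_isSphericallySymmetric_iff.2 h₁, ?_, fun p hp hp' =>
      (exists_ncard_next_y_iff p).2 (h₂ p hp hp'), fun p hp => ?_⟩
    · obtain ⟨N, hN⟩ := h0.2 (h₃ 0)
      exact ⟨N, fun y ys h => hN [] y ys h⟩
    · obtain ⟨p, rfl⟩ := Nat.exists_eq_add_of_le' (le_trans one_le_two hp)
      exact (exists_ncard_next_x_iff p).2 (h₃ p)

end Tree

/-! ### Orbits of multiplication by `q`. -/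

section Orbits

/-- The number of `r` with `i * q ^ r ≤ x`. -/
def orbitCount (q x i : ℕ) : ℕ := Nat.clog q (x / i + 1)

theorem lt_orbitCount_iff {q : ℕ} (hq : 2 ≤ q) {x i r : ℕ} (hi : 1 ≤ i) :
    r < orbitCount q x i ↔ i * q ^ r ≤ x := by
  rw [orbitCount, Nat.lt_clog_iff_pow_lt (by omega), Nat.lt_succ_iff, Nat.le_div_iff_mul_le hi,
    mul_comm]

theorem orbitCount_le_iff {q : ℕ} (hq : 2 ≤ q) {x i r : ℕ} (hi : 1 ≤ i) :
    orbitCount q x i ≤ r ↔ x < i * q ^ r := by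
  rw [← not_lt, lt_orbitCount_iff hq hi, not_le]

theorem orbitCount_mono {q x x' : ℕ} (h : x ≤ x') (i : ℕ) :
    orbitCount q x i ≤ orbitCount q x' i :=
  Nat.clog_mono_right _ (Nat.succ_le_succ (Nat.div_le_div_right h))

variable {m₁ m₂ : ℕ}

/-- The subsequence of the letters of indices `i, iq, iq², …`. -/
def SymSeq.orbit (q i : ℕ) (z : SymSeq m₁ m₂) : SymSeq m₁ m₂ := ⟨fun l => z.letter (i * q ^ l - 1)⟩

theorem mem_multInvSet_iff {q : ℕ} {Ω : Set (SymSeq m₁ m₂)} {z : SymSeq m₁ m₂} :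
    z ∈ multInvSet q Ω ↔ ∀ i, ¬ q ∣ i → z.orbit q i ∈ Ω := Iff.rfl

theorem exists_eq_mul_pow_of_pos {q : ℕ} (hq : 2 ≤ q) {k : ℕ} (hk : 1 ≤ k) :
    ∃ i l, 1 ≤ i ∧ ¬ q ∣ i ∧ k = i * q ^ l := by
  obtain ⟨e, n, hn, h⟩ := Nat.exists_eq_pow_mul_and_not_dvd (n := k) (by omega) q (by omega)
  refine ⟨n, e, Nat.one_le_iff_ne_zero.2 ?_, hn, by rw [h, mul_comm]⟩
  rintro rfl
  exact hn (dvd_zero q)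

theorem mul_pow_inj_of_not_dvd {q : ℕ} (hq : 2 ≤ q) {i i' l l' : ℕ} (hi : ¬ q ∣ i)
    (hi' : ¬ q ∣ i') (h : i * q ^ l = i' * q ^ l') : i = i' ∧ l = l' := by
  wlog hl : l ≤ l' generalizing i i' l l'
  · obtain ⟨h₁, h₂⟩ := this hi' hi h.symm (by omega)
    exact ⟨h₁.symm, h₂.symm⟩
  obtain ⟨e, rfl⟩ := Nat.exists_eq_add_of_le hl
  have hpos : 0 < q ^ l := by positivity
  have h₁ : i = i' * q ^ e := by
    apply Nat.eq_of_mul_eq_mul_right hpos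
    rw [h, pow_add]; ring
  rcases e with _ | e
  · simpa using h₁
  · exact absurd ⟨i' * q ^ e, by rw [h₁, pow_succ]; ring⟩ hi

/-- The orbits partition the positive integers, so the subsequences along them can be prescribed
independently. -/
theorem exists_orbit_eq {q : ℕ} (hq : 2 ≤ q) (s : ℕ → SymSeq m₁ m₂) :
    ∃ z : SymSeq m₁ m₂, ∀ i, ¬ q ∣ i → z.orbit q i = s i := by
  -- The letter stored at position `k` has index `k + 1`, which is the integer factored here.
  choose f g _ hf h using fun k : ℕ => exists_eq_mul_pow_of_pos hq (Nat.succ_le_succ k.zero_le)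
  refine ⟨⟨fun k => (s (f k)).letter (g k)⟩, fun i hi => ?_⟩
  ext1
  funext l
  have hi0 : i ≠ 0 := by rintro rfl; exact hi (dvd_zero q)
  have hpos : 0 < i * q ^ l := by positivity
  obtain ⟨h₁, h₂⟩ := mul_pow_inj_of_not_dvd hq (hf (i * q ^ l - 1)) hi
    ((h (i * q ^ l - 1)).symm.trans (Nat.succ_pred_eq_of_pos hpos))
  simp only [orbit, h₁, h₂]

/-- The first elements `i ≤ N` of the orbits of the multiplication by `q`. -/
def blockIdx (q N : ℕ) : Finset ℕ := (Finset.Icc 1 N).filter fun i => ¬ q ∣ i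

theorem mem_blockIdx {q N i : ℕ} : i ∈ blockIdx q N ↔ 1 ≤ i ∧ i ≤ N ∧ ¬ q ∣ i := by
  simp [blockIdx, and_assoc]

/-- An `i` with `N < i ≤ M` has `orbitCount q N i = 0` and adds no constraint. The slack in `M` lets
letters and second coordinates be indexed by the same set of orbits. -/
theorem forall_lt_iff_forall_orbit {A : Type*} {q : ℕ} (hq : 2 ≤ q) (f g : ℕ → A) {N M : ℕ}
    (hN : N ≤ M) :
    (∀ k < N, f k = g k) ↔
      ∀ i ∈ blockIdx q M, ∀ l < orbitCount q N i, f (i * q ^ l - 1) = g (i * q ^ l - 1) := by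
  constructor
  · intro h i hi l hl
    rw [mem_blockIdx] at hi
    rw [lt_orbitCount_iff hq hi.1] at hl
    have : 0 < i * q ^ l := Nat.mul_pos hi.1 (by positivity)
    exact h _ (by omega)
  · intro h k hk
    obtain ⟨i, l, hi, hi', h'⟩ := exists_eq_mul_pow_of_pos hq (Nat.succ_le_succ k.zero_le)
    have hle : i ≤ i * q ^ l := Nat.le_mul_of_pos_right _ (by positivity)
    have := h i (mem_blockIdx.2 ⟨hi, by omega, hi'⟩) l
      ((lt_orbitCount_iff hq hi).2 (by omega))
    rwa [← h'] at this

end Orbits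

/-! ### Balls as products of cylinders over orbits, and their number. -/

section Scales

/-- The number of second coordinates that determine a ball of radius `m₁ ^ (-n)`. -/
noncomputable def squareHeight (m₁ m₂ n : ℕ) : ℕ := ⌈(n : ℝ) / gammaRatio m₁ m₂⌉₊

/-- The size of the word that a ball of radius `m₁ ^ (-n)` determines in the orbit of `i`. -/
noncomputable def blockSize (q m₁ m₂ n i : ℕ) : ℕ × ℕ :=
  (orbitCount q n i, orbitCount q (squareHeight m₁ m₂ n) i - orbitCount q n i)

variable {m₁ m₂ : ℕ}

theorem gammaRatio_pos (hm₂ : 2 ≤ m₂) (hm : m₂ < m₁) : 0 < gammaRatio m₁ m₂ :=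
  div_pos (Real.log_pos (by exact_mod_cast hm₂)) (Real.log_pos (by exact_mod_cast (by omega : 1 < m₁)))

theorem gammaRatio_lt_one (hm₂ : 2 ≤ m₂) (hm : m₂ < m₁) : gammaRatio m₁ m₂ < 1 := by
  have h₁ : (0 : ℝ) < m₂ := by positivity
  have h₂ : (m₂ : ℝ) < m₁ := by exact_mod_cast hm
  rw [gammaRatio, div_lt_one (Real.log_pos (by exact_mod_cast (by omega : 1 < m₁)))]
  exact Real.log_lt_log h₁ h₂

theorem le_squareHeight (hm₂ : 2 ≤ m₂) (hm : m₂ < m₁) (n : ℕ) : n ≤ squareHeight m₁ m₂ n := by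
  have h : (n : ℝ) ≤ squareHeight m₁ m₂ n := by
    refine le_trans ?_ (Nat.le_ceil _)
    rw [le_div_iff₀ (gammaRatio_pos hm₂ hm)]
    exact mul_le_of_le_one_right n.cast_nonneg (gammaRatio_lt_one hm₂ hm).le
  exact_mod_cast h

theorem squareHeight_mono (hm₂ : 2 ≤ m₂) (hm : m₂ < m₁) : Monotone (squareHeight m₁ m₂) := by
  intro a b h
  apply Nat.ceil_mono
  have := (gammaRatio_pos hm₂ hm).le
  gcongr

/-- For distinct sequences, `b ^ (-c * d) ≤ b ^ (-n)` means `n / c ≤ d`. The value `c = 1` yields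
the first `n` letters, and `c = γ` yields `squareHeight`. -/
theorem prefixDist_le_iff {A : Type} {b c : ℝ} (hb : 1 < b) (hc : 0 < c) (s t : ℕ → A) (n : ℕ) :
    prefixDist b c s t ≤ (b ^ n)⁻¹ ↔ ∀ k < ⌈(n : ℝ) / c⌉₊, s k = t k := by
  have hb0 : 0 < b := by linarith
  unfold prefixDist
  split_ifs with h
  · subst h
    simp [hb0.le]
  · rw [← Real.rpow_natCast, ← Real.rpow_neg hb0.le, Real.rpow_le_rpow_left_iff hb, neg_le_neg_iff,
      ← div_le_iff₀' hc, ← Nat.ceil_le,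
      ← PiNat.mem_cylinder_iff_le_firstDiff (E := fun _ => A) h, PiNat.mem_cylinder_iff]

theorem SymSeq.dist_le_iff (hm₂ : 2 ≤ m₂) (hm : m₂ < m₁) (z w : SymSeq m₁ m₂) (n : ℕ) :
    dist z w ≤ ((m₁ : ℝ) ^ n)⁻¹ ↔
      (∀ k < n, z.letter k = w.letter k) ∧
        ∀ k < squareHeight m₁ m₂ n, (z.letter k).2 = (w.letter k).2 := by
  have hb : (1 : ℝ) < m₁ := by exact_mod_cast (by omega : 1 < m₁)
  change symDist z w ≤ _ ↔ _
  rw [symDist, max_le_iff, prefixDist_le_iff hb one_pos,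
    prefixDist_le_iff hb (gammaRatio_pos hm₂ hm)]
  simp [squareHeight, snds]

variable {q : ℕ}

theorem SymSeq.dist_le_iff_forall_word (hm₂ : 2 ≤ m₂) (hm : m₂ < m₁) (hq : 2 ≤ q)
    (z w : SymSeq m₁ m₂) (n : ℕ) :
    dist z w ≤ ((m₁ : ℝ) ^ n)⁻¹ ↔ ∀ i ∈ blockIdx q (squareHeight m₁ m₂ n),
      (z.orbit q i).word (blockSize q m₁ m₂ n i).1 (blockSize q m₁ m₂ n i).2 =
        (w.orbit q i).word (blockSize q m₁ m₂ n i).1 (blockSize q m₁ m₂ n i).2 := by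
  rw [SymSeq.dist_le_iff hm₂ hm, forall_lt_iff_forall_orbit hq _ _ (le_squareHeight hm₂ hm n),
    forall_lt_iff_forall_orbit hq (fun k => (z.letter k).2) (fun k => (w.letter k).2) le_rfl,
    ← forall₂_and]
  refine forall₂_congr fun i _ => ?_
  rw [word_eq_iff, blockSize, Nat.add_sub_cancel' (orbitCount_mono (le_squareHeight hm₂ hm n) i)]
  rfl

/-- The words that determine the ball of radius `m₁ ^ (-n)` around `z`. -/
noncomputable def squareCode (q n : ℕ) (z : SymSeq m₁ m₂) :
    blockIdx q (squareHeight m₁ m₂ n) → GenWord m₁ m₂ :=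
  fun i => (z.orbit q i).word (blockSize q m₁ m₂ n i).1 (blockSize q m₁ m₂ n i).2

theorem squareCode_eq_iff (hm₂ : 2 ≤ m₂) (hm : m₂ < m₁) (hq : 2 ≤ q) (z w : SymSeq m₁ m₂) (n : ℕ) :
    squareCode q n z = squareCode q n w ↔ dist z w ≤ ((m₁ : ℝ) ^ n)⁻¹ := by
  rw [SymSeq.dist_le_iff_forall_word hm₂ hm hq, funext_iff]
  simp [squareCode]

/-- The number of balls of radius `m₁ ^ (-n)` that meet `X_Ω`. -/
noncomputable def squareCount (q : ℕ) (Ω : Set (SymSeq m₁ m₂)) (n : ℕ) : ℕ :=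
  ∏ i ∈ blockIdx q (squareHeight m₁ m₂ n),
    (pref Ω (blockSize q m₁ m₂ n i).1 (blockSize q m₁ m₂ n i).2).ncard

/-- The remaining orbits are filled with one fixed point of `Ω`. -/
theorem exists_mem_multInvSet_orbit_eq (hq : 2 ≤ q) {Ω : Set (SymSeq m₁ m₂)} (hne : Ω.Nonempty)
    {N : ℕ} (s : blockIdx q N → SymSeq m₁ m₂) (hs : ∀ i, s i ∈ Ω) :
    ∃ z ∈ multInvSet q Ω, ∀ i : blockIdx q N, z.orbit q i = s i := by
  classical
  obtain ⟨z, hz⟩ := exists_orbit_eq hq fun i => if h : i ∈ blockIdx q N then s ⟨i, h⟩ else hne.some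
  refine ⟨z, fun i hi => ?_, fun i => ?_⟩
  · change z.orbit q i ∈ Ω
    rw [hz i hi]
    split_ifs with h
    · exact hs _
    · exact hne.some_mem
  · rw [hz i (mem_blockIdx.1 i.2).2.2, dif_pos i.2]

theorem orbit_mem (Ω : Set (SymSeq m₁ m₂)) {z : SymSeq m₁ m₂} (hz : z ∈ multInvSet q Ω) {N : ℕ}
    (i : blockIdx q N) : z.orbit q i ∈ Ω :=
  mem_multInvSet_iff.1 hz i (mem_blockIdx.1 i.2).2.2

theorem squareCode_image (hq : 2 ≤ q) {Ω : Set (SymSeq m₁ m₂)} (hne : Ω.Nonempty) (n : ℕ) :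
    squareCode q n '' multInvSet q Ω = ↑(Fintype.piFinset
      fun i : blockIdx q (squareHeight m₁ m₂ n) =>
        (finite_pref Ω (blockSize q m₁ m₂ n i).1 (blockSize q m₁ m₂ n i).2).toFinset) := by
  ext c
  simp only [Finset.mem_coe, Fintype.mem_piFinset, Finite.mem_toFinset, pref_eq_image]
  constructor
  · rintro ⟨z, hz, rfl⟩ i
    exact ⟨_, orbit_mem Ω hz i, rfl⟩
  · intro h
    choose s hs hsc using h
    obtain ⟨z, hz, hzs⟩ := exists_mem_multInvSet_orbit_eq hq hne s hs
    exact ⟨z, hz, funext fun i => by rw [squareCode, hzs, hsc]⟩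

theorem finite_squareCode_image (hq : 2 ≤ q) {Ω : Set (SymSeq m₁ m₂)} (hne : Ω.Nonempty) (n : ℕ) :
    (squareCode q n '' multInvSet q Ω).Finite := by
  rw [squareCode_image hq hne]
  exact Finset.finite_toSet _

theorem ncard_squareCode_image (hq : 2 ≤ q) {Ω : Set (SymSeq m₁ m₂)} (hne : Ω.Nonempty) (n : ℕ) :
    (squareCode q n '' multInvSet q Ω).ncard = squareCount q Ω n := by
  rw [squareCode_image hq hne, ncard_coe_finset, Fintype.card_piFinset, squareCount,
    ← Finset.prod_coe_sort (blockIdx q (squareHeight m₁ m₂ n))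
      fun i => (pref Ω (blockSize q m₁ m₂ n i).1 (blockSize q m₁ m₂ n i).2).ncard]
  exact Finset.prod_congr rfl fun i _ => (ncard_eq_toFinset_card _ _).symm

theorem ncard_pref_pos {Ω : Set (SymSeq m₁ m₂)} (hne : Ω.Nonempty) (p l : ℕ) :
    0 < (pref Ω p l).ncard := by
  rw [ncard_pos (finite_pref Ω p l), pref_eq_image]
  exact hne.image _

theorem squareCount_pos {Ω : Set (SymSeq m₁ m₂)} (hne : Ω.Nonempty) (n : ℕ) :
    0 < squareCount q Ω n :=
  Finset.prod_pos fun _ _ => ncard_pref_pos hne _ _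

end Scales

/-! ### Compactness of the symbolic space and of `X_Ω`. -/

section Compactness

variable {m₁ m₂ : ℕ}

theorem inv_pow_pos_of_pos {m : ℕ} (hm : 0 < m) (n : ℕ) : 0 < ((m : ℝ) ^ n)⁻¹ := by positivity

theorem exists_inv_pow_lt {m : ℕ} (hm : 1 < m) {ε : ℝ} (hε : 0 < ε) :
    ∃ n : ℕ, ((m : ℝ) ^ n)⁻¹ < ε := by
  have h : (m : ℝ)⁻¹ < 1 := inv_lt_one_of_one_lt₀ (by exact_mod_cast hm)
  obtain ⟨n, hn⟩ := exists_pow_lt_of_lt_one hε h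
  exact ⟨n, by rwa [← inv_pow]⟩

/-- With `SymSeq.continuous_letter`, this identifies the metric topology with the product topology,
which provides compactness and the continuity of `SymSeq.orbit`. -/
theorem SymSeq.continuous_mk (hm₂ : 2 ≤ m₂) (hm : m₂ < m₁) :
    Continuous (SymSeq.mk : (ℕ → Fin m₁ × Fin m₂) → SymSeq m₁ m₂) := by
  rw [continuous_iff_continuousAt]
  intro s
  rw [ContinuousAt, Metric.tendsto_nhds]
  intro ε hε
  obtain ⟨n, hn⟩ := exists_inv_pow_lt (by omega : 1 < m₁) hε
  have hopen := PiNat.isOpen_cylinder (fun _ : ℕ => Fin m₁ × Fin m₂) s (squareHeight m₁ m₂ n)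
  filter_upwards [hopen.mem_nhds (PiNat.self_mem_cylinder s _)] with t ht
  refine lt_of_le_of_lt ?_ hn
  rw [PiNat.mem_cylinder_iff] at ht
  rw [SymSeq.dist_le_iff hm₂ hm]
  exact ⟨fun k hk => ht k (hk.trans_le (le_squareHeight hm₂ hm n)), fun k hk => congrArg Prod.snd (ht k hk)⟩

theorem SymSeq.continuous_letter (hm₂ : 2 ≤ m₂) (hm : m₂ < m₁) :
    Continuous (SymSeq.letter : SymSeq m₁ m₂ → _) := by
  refine continuous_pi fun k => ?_
  rw [continuous_iff_continuousAt]
  intro z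
  refine tendsto_nhds_of_eventually_eq ?_
  filter_upwards [Metric.closedBall_mem_nhds z (inv_pow_pos_of_pos (by omega : 0 < m₁) (k + 1))]
    with w hw
  exact ((SymSeq.dist_le_iff hm₂ hm _ _ _).1 (Metric.mem_closedBall.1 hw)).1 k (Nat.lt_succ_self k)

theorem SymSeq.compactSpace (hm₂ : 2 ≤ m₂) (hm : m₂ < m₁) : CompactSpace (SymSeq m₁ m₂) := by
  have h := isCompact_range (SymSeq.continuous_mk hm₂ hm)
  rw [(show Function.Surjective (SymSeq.mk : (ℕ → Fin m₁ × Fin m₂) → SymSeq m₁ m₂) from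
    fun z => ⟨z.letter, rfl⟩).range_eq] at h
  exact ⟨h⟩

theorem isCompact_multInvSet (hm₂ : 2 ≤ m₂) (hm : m₂ < m₁) (q : ℕ) {Ω : Set (SymSeq m₁ m₂)}
    (hΩ : IsClosed Ω) : IsCompact (multInvSet q Ω) := by
  have := SymSeq.compactSpace hm₂ hm
  have hc : ∀ i, Continuous (SymSeq.orbit q i : SymSeq m₁ m₂ → _) := fun i =>
    (SymSeq.continuous_mk hm₂ hm).comp
      (continuous_pi fun l => (continuous_apply _).comp (SymSeq.continuous_letter hm₂ hm))
  have : multInvSet q Ω = ⋂ i, ⋂ (_ : ¬ q ∣ i), SymSeq.orbit q i ⁻¹' Ω := by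
    ext z; simp [mem_multInvSet_iff]
  rw [this]
  exact (isClosed_iInter fun i => isClosed_iInter fun _ => hΩ.preimage (hc i)).isCompact

end Compactness

/-! ### Covering numbers and the Minkowski dimension. -/

section Covering

/-- At this radius, closeness is an equivalence relation with classes the fibres of `code`. A cover
needs one centre in each class that meets `S`, and one suffices. -/
theorem coveringNumber_eq_encard_image {E C : Type*} [PseudoEMetricSpace E] {S : Set E} {ε : ℝ≥0}
    (code : E → C) (h : ∀ z w, edist z w ≤ ε ↔ code z = code w) :
    Metric.coveringNumber ε S = (code '' S).encard := by
  apply le_antisymm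
  · obtain ⟨T, hTS, hT⟩ := SurjOn.exists_bijOn_subset (surjOn_image code S)
    rw [← hT.image_eq, hT.injOn.encard_image]
    refine Metric.IsCover.coveringNumber_le_encard hTS ?_
    intro z hz
    obtain ⟨w, hw, hwz⟩ := hT.surjOn (mem_image_of_mem code hz)
    exact ⟨w, hw, (h z w).2 hwz.symm⟩
  · refine le_iInf fun T => le_iInf fun hTS => le_iInf fun hT => ?_
    refine le_trans (encard_le_encard ?_) (encard_image_le code T)
    rintro _ ⟨z, hz, rfl⟩
    obtain ⟨w, hw, hwz⟩ := hT hz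
    exact ⟨w, hw, ((h z w).1 hwz).symm⟩

variable {m₁ m₂ q : ℕ}

theorem coveringNumber_multInvSet (hm₂ : 2 ≤ m₂) (hm : m₂ < m₁) (hq : 2 ≤ q)
    {Ω : Set (SymSeq m₁ m₂)} (hne : Ω.Nonempty) (n : ℕ) :
    Metric.coveringNumber ((m₁ : ℝ≥0) ^ n)⁻¹ (multInvSet q Ω) = squareCount q Ω n := by
  rw [coveringNumber_eq_encard_image (squareCode q n), ← ncard_squareCode_image hq hne,
    (finite_squareCode_image hq hne n).cast_ncard_eq]
  intro z w
  rw [squareCode_eq_iff hm₂ hm hq, edist_nndist, ENNReal.coe_le_coe, ← NNReal.coe_le_coe]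
  simp

theorem hasMinkowskiDim_multInvSet (hm₂ : 2 ≤ m₂) (hm : m₂ < m₁) (hq : 2 ≤ q)
    {Ω : Set (SymSeq m₁ m₂)} (hΩ : IsClosed Ω) (hne : Ω.Nonempty) {h : ℝ}
    (hh : Tendsto (fun n : ℕ => Real.log (squareCount q Ω n) / n) atTop (𝓝 h)) :
    HasMinkowskiDim (multInvSet q Ω) (h / Real.log m₁) := by
  refine ⟨(isCompact_multInvSet hm₂ hm q hΩ).totallyBounded, ?_⟩
  have hm1 : (1 : ℝ) < m₁ := by exact_mod_cast (by omega : 1 < m₁)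
  have hlog : 0 < Real.log m₁ := Real.log_pos hm1
  have hm0 : (0 : ℝ) < m₁ := by linarith
  -- The scale with `m₁ ^ (-(k + 1)) ≤ ε ≤ m₁ ^ (-k)`. The covering number at `ε` lies between those
  -- at the two ends, and the shift by one vanishes in the limit.
  set k : ℝ≥0 → ℕ := fun ε => ⌊Real.log (1 / (ε : ℝ)) / Real.log m₁⌋₊ with hk
  have hu : Tendsto (fun ε : ℝ≥0 => Real.log (1 / (ε : ℝ))) (𝓝[>] 0) atTop := by
    have h1 : Tendsto (fun ε : ℝ≥0 => (ε : ℝ)) (𝓝[>] 0) (𝓝[>] 0) := by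
      refine tendsto_nhdsWithin_iff.2 ⟨?_, ?_⟩
      · exact (NNReal.continuous_coe.tendsto' 0 0 rfl).mono_left nhdsWithin_le_nhds
      · filter_upwards [self_mem_nhdsWithin] with ε hε
        exact NNReal.coe_pos.2 hε
    simp only [one_div]
    exact Real.tendsto_log_atTop.comp (tendsto_inv_nhdsGT_zero.comp h1)
  have hkt : Tendsto k (𝓝[>] 0) atTop :=
    tendsto_nat_floor_atTop.comp (hu.atTop_div_const hlog)
  have hlow : Tendsto (fun n : ℕ => Real.log (squareCount q Ω n) / ((n + 1 : ℕ) * Real.log m₁))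
      atTop (𝓝 (h / Real.log m₁)) := by
    have h2 : Tendsto (fun n : ℕ => (n : ℝ) / (n + 1)) atTop (𝓝 1) :=
      tendsto_natCast_div_add_atTop 1
    have h3 := (hh.mul h2).div_const (Real.log m₁)
    rw [mul_one] at h3
    refine h3.congr' ?_
    filter_upwards [eventually_gt_atTop 0] with n hn
    have : (n : ℝ) ≠ 0 := by positivity
    push_cast
    field_simp
  have hup : Tendsto (fun n : ℕ => Real.log (squareCount q Ω (n + 1)) / (n * Real.log m₁))
      atTop (𝓝 (h / Real.log m₁)) := by
    have h2 : Tendsto (fun n : ℕ => ((n : ℝ) / (n + 1))⁻¹) atTop (𝓝 1) := by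
      simpa using (tendsto_natCast_div_add_atTop (1 : ℝ)).inv₀ one_ne_zero
    have h3 := (((tendsto_add_atTop_iff_nat 1).2 hh).mul h2).div_const (Real.log m₁)
    rw [mul_one] at h3
    refine h3.congr' ?_
    filter_upwards [eventually_gt_atTop 0] with n hn
    have : (n : ℝ) ≠ 0 := by positivity
    push_cast
    field_simp
  have hpos : ∀ n, (1 : ℝ) ≤ squareCount q Ω n := fun n => by
    exact_mod_cast squareCount_pos hne n
  have key : ∀ᶠ ε : ℝ≥0 in 𝓝[>] 0, 0 < k ε ∧ (k ε : ℝ) * Real.log m₁ ≤ Real.log (1 / (ε : ℝ)) ∧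
      Real.log (1 / (ε : ℝ)) ≤ (k ε + 1 : ℕ) * Real.log m₁ ∧
      squareCount q Ω (k ε) ≤ (Metric.coveringNumber ε (multInvSet q Ω)).toNat ∧
      (Metric.coveringNumber ε (multInvSet q Ω)).toNat ≤ squareCount q Ω (k ε + 1) := by
    filter_upwards [self_mem_nhdsWithin, hu.eventually_ge_atTop 0, hkt.eventually_gt_atTop 0]
      with ε hε hε1 hkε
    have hε0 : (0 : ℝ) < ε := NNReal.coe_pos.2 hε
    have h1 : (k ε : ℝ) * Real.log m₁ ≤ Real.log (1 / (ε : ℝ)) := by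
      rw [← le_div_iff₀ hlog]
      exact Nat.floor_le (by positivity)
    have h2 : Real.log (1 / (ε : ℝ)) ≤ (k ε + 1 : ℕ) * Real.log m₁ := by
      rw [← div_le_iff₀ hlog]
      push_cast
      exact (Nat.lt_floor_add_one _).le
    have h3 : ε ≤ ((m₁ : ℝ≥0) ^ k ε)⁻¹ := by
      rw [← NNReal.coe_le_coe]
      push_cast
      rw [le_inv_comm₀ hε0 (by positivity), ← one_div,
        ← Real.log_le_log_iff (by positivity) (by positivity), Real.log_pow]
      exact h1
    have h4 : ((m₁ : ℝ≥0) ^ (k ε + 1))⁻¹ ≤ ε := by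
      rw [← NNReal.coe_le_coe]
      push_cast
      rw [inv_le_comm₀ (by positivity) hε0, ← one_div,
        ← Real.log_le_log_iff (by positivity) (by positivity), Real.log_pow]
      exact h2
    have h5 := Metric.coveringNumber_anti (A := multInvSet q Ω) h3
    have h6 := Metric.coveringNumber_anti (A := multInvSet q Ω) h4
    rw [coveringNumber_multInvSet hm₂ hm hq hne] at h5 h6
    refine ⟨hkε, h1, h2, ?_, ?_⟩
    -- The bound `h6` at the next scale makes the covering number finite, so `toNat` does not return
    -- its default value `0`.
    · have := ENat.toNat_le_toNat h5 (ne_top_of_le_ne_top (ENat.natCast_ne_top _) h6)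
      simpa using this
    · exact ENat.toNat_le_of_le_natCast h6
  refine tendsto_of_tendsto_of_tendsto_of_le_of_le' (hlow.comp hkt) (hup.comp hkt) ?_ ?_
  · filter_upwards [key] with ε ⟨h0, h1, h2, h3, h4⟩
    have h5 : (0 : ℝ) < k ε := by exact_mod_cast h0
    have h6 : 0 < Real.log (1 / (ε : ℝ)) := lt_of_lt_of_le (by positivity) h1
    have h7 : (squareCount q Ω (k ε) : ℝ) ≤ (Metric.coveringNumber ε (multInvSet q Ω)).toNat := by
      exact_mod_cast h3
    have h8 := Real.log_le_log (by linarith [hpos (k ε)]) h7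
    have h9 := Real.log_nonneg (hpos (k ε))
    simp only [Function.comp]
    gcongr
  · filter_upwards [key] with ε ⟨h0, h1, h2, h3, h4⟩
    have h5 : (0 : ℝ) < k ε := by exact_mod_cast h0
    have h7 : ((Metric.coveringNumber ε (multInvSet q Ω)).toNat : ℝ) ≤
        squareCount q Ω (k ε + 1) := by exact_mod_cast h4
    have h10 : (squareCount q Ω (k ε) : ℝ) ≤ (Metric.coveringNumber ε (multInvSet q Ω)).toNat := by
      exact_mod_cast h3
    have h8 := Real.log_le_log (by linarith [hpos (k ε)]) h7
    have h9 := Real.log_nonneg (hpos (k ε + 1))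
    simp only [Function.comp]
    gcongr

end Covering

/-! ### Densities of classes and convergence of `log (N n) / n`. -/

section Limit

theorem card_blockIdx (q N : ℕ) : (blockIdx q N).card = N - N / q := by
  have h := Finset.card_filter_add_card_filter_not (s := Finset.Icc 1 N) (fun i => q ∣ i)
  have h' : ((Finset.Icc 1 N).filter fun i => q ∣ i).card = N / q := by
    rw [← Nat.Ioc_filter_dvd_card_eq_div]; rfl
  rw [Nat.card_Icc, h'] at h
  rw [blockIdx]
  omega

theorem tendsto_natCast_natDiv_div {x : ℕ → ℕ} {t : ℝ}
    (hx : Tendsto (fun n => (x n : ℝ) / n) atTop (𝓝 t)) (q : ℕ) :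
    Tendsto (fun n => ((x n / q : ℕ) : ℝ) / n) atTop (𝓝 (t / q)) := by
  have h1 : Tendsto (fun n : ℕ => (x n : ℝ) / n / q - 1 / n) atTop (𝓝 (t / q)) := by
    simpa using (hx.div_const (q : ℝ)).sub tendsto_one_div_atTop_nhds_zero_nat
  refine tendsto_of_tendsto_of_tendsto_of_le_of_le h1 (hx.div_const (q : ℝ)) (fun n => ?_)
    fun n => ?_
  · simp only
    rw [div_right_comm, ← sub_div]
    gcongr
    have := Nat.lt_floor_add_one ((x n : ℝ) / q)
    rw [Nat.floor_div_eq_div] at this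
    linarith
  · simp only
    rw [div_right_comm]
    gcongr
    exact Nat.cast_div_le

theorem tendsto_card_blockIdx {q : ℕ} {x : ℕ → ℕ} {t : ℝ}
    (hx : Tendsto (fun n => (x n : ℝ) / n) atTop (𝓝 t)) :
    Tendsto (fun n => ((blockIdx q (x n)).card : ℝ) / n) atTop (𝓝 (t - t / q)) := by
  have h := hx.sub (tendsto_natCast_natDiv_div hx q)
  refine h.congr fun n => ?_
  rw [card_blockIdx, Nat.cast_sub (Nat.div_le_self _ _), sub_div]

variable {m₁ m₂ q : ℕ}

theorem squareHeight_le (hm₂ : 2 ≤ m₂) (hm : m₂ < m₁) {n : ℕ} (hn : 1 ≤ n) :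
    (squareHeight m₁ m₂ n : ℝ) ≤ (1 / gammaRatio m₁ m₂ + 1) * n := by
  have h := gammaRatio_pos hm₂ hm
  have h1 : (1 : ℝ) ≤ n := by exact_mod_cast hn
  refine (Nat.ceil_lt_add_one (by positivity)).le.trans ?_
  rw [add_mul, one_mul, one_div_mul_eq_div]
  gcongr

theorem tendsto_squareHeight_div (hm₂ : 2 ≤ m₂) (hm : m₂ < m₁) :
    Tendsto (fun n : ℕ => (squareHeight m₁ m₂ n : ℝ) / n) atTop (𝓝 (1 / gammaRatio m₁ m₂)) := by
  have h := gammaRatio_pos hm₂ hm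
  have := (tendsto_nat_ceil_mul_div_atTop (R := ℝ) (a := 1 / gammaRatio m₁ m₂)
    (by positivity)).comp tendsto_natCast_atTop_atTop
  refine this.congr fun n => ?_
  simp only [Function.comp, squareHeight, one_div_mul_eq_div]

/-- The first elements of the orbits of which `p` elements are at most `n` and `P` elements are at
most `M`. -/
def blockClass (q n M p P : ℕ) : Finset ℕ :=
  (blockIdx q M).filter fun i => orbitCount q n i = p ∧ orbitCount q M i = P

/-- Each equation on an orbit count confines `i` to a half-open interval, so the class is made of
the `i` with `¬ q ∣ i` in an intersection of two intervals. If the intersection is empty, truncated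
subtraction gives `0`. -/
theorem card_blockClass (hq : 2 ≤ q) {n M : ℕ} (p P : ℕ) :
    (blockClass q n M p (P + 1)).card =
      (blockIdx q (min (if p = 0 then M else n / q ^ (p - 1)) (M / q ^ P))).card -
        (blockIdx q (max (n / q ^ p) (M / q ^ (P + 1)))).card := by
  set a := max (n / q ^ p) (M / q ^ (P + 1))
  set b := min (if p = 0 then M else n / q ^ (p - 1)) (M / q ^ P)
  have hb : b ≤ M := (min_le_right _ _).trans (Nat.div_le_self _ _)
  have hmono : ∀ {x y : ℕ}, x ≤ y → blockIdx q x ⊆ blockIdx q y := fun h i hi => by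
    rw [mem_blockIdx] at hi ⊢
    exact ⟨hi.1, hi.2.1.trans h, hi.2.2⟩
  have hset : blockClass q n M p (P + 1) = blockIdx q b \ blockIdx q a := by
    ext i
    simp only [blockClass, Finset.mem_filter, Finset.mem_sdiff, mem_blockIdx]
    have key : ∀ x r, 1 ≤ i → (orbitCount q x i ≤ r ↔ x / q ^ r < i) := fun x r hi => by
      rw [orbitCount_le_iff hq hi, Nat.div_lt_iff_lt_mul (by positivity)]
    have key' : ∀ x r, 1 ≤ i → (orbitCount q x i = r + 1 ↔ i ≤ x / q ^ r ∧ x / q ^ (r + 1) < i) :=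
      fun x r hi => by
        rw [← key x _ hi, ← not_lt (a := x / q ^ r), ← key x _ hi]
        omega
    have key0 : ∀ x, 1 ≤ i → (orbitCount q x i = 0 ↔ x / q ^ 0 < i) := fun x hi => by
      rw [← key x _ hi]; omega
    constructor
    · rintro ⟨⟨h1, h2, h3⟩, h4, h5⟩
      rw [key' _ _ h1] at h5
      rcases p with _ | p
      · rw [key0 _ h1] at h4
        simp only [a, b]
        refine ⟨⟨h1, ?_, h3⟩, fun h => ?_⟩
        · simpa using ⟨h2, h5.1⟩
        · have := h.2.1
          simp only [le_max_iff] at this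
          omega
      · rw [key' _ _ h1] at h4
        simp only [a, b]
        refine ⟨⟨h1, ?_, h3⟩, fun h => ?_⟩
        · simpa using ⟨h4.1, h5.1⟩
        · have := h.2.1
          simp only [le_max_iff] at this
          omega
    · rintro ⟨⟨h1, h2, h3⟩, h4⟩
      have h6 : ¬ i ≤ a := fun h => h4 ⟨h1, h, h3⟩
      refine ⟨⟨h1, h2.trans hb, h3⟩, ?_⟩
      simp only [a, b, le_max_iff, le_min_iff, not_or, not_le] at h2 h6
      rw [key' _ _ h1]
      refine ⟨?_, h2.2, h6.2⟩
      rcases p with _ | p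
      · rw [key0 _ h1]; exact h6.1
      · rw [key' _ _ h1]; exact ⟨by simpa using h2.1, h6.1⟩
  rw [hset]
  rcases le_total a b with h | h
  · exact Finset.card_sdiff_of_subset (hmono h)
  · rw [Finset.sdiff_eq_empty_iff_subset.2 (hmono h), Finset.card_empty,
      Nat.sub_eq_zero_of_le (Finset.card_le_card (hmono h))]

/-- An `i` with count `P ≥ 1` satisfies `i * q ^ (P - 1) ≤ M`. The geometric decay in `P` feeds the
dominated convergence below. -/
theorem card_blockClass_le (hq : 2 ≤ q) (n M p P : ℕ) :
    (blockClass q n M p P).card ≤ q * M / q ^ P := by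
  have h : blockClass q n M p P ⊆ Finset.Icc 1 (q * M / q ^ P) := by
    intro i hi
    simp only [blockClass, Finset.mem_filter, mem_blockIdx] at hi
    obtain ⟨⟨h1, h2, h3⟩, h4, h5⟩ := hi
    rw [Finset.mem_Icc, Nat.le_div_iff_mul_le (by positivity)]
    refine ⟨h1, ?_⟩
    rcases P with _ | P
    · simpa using h2.trans (Nat.le_mul_of_pos_left M (by omega))
    · have := (lt_orbitCount_iff hq h1 (x := M) (r := P)).1 (by omega)
      calc i * q ^ (P + 1) = q * (i * q ^ P) := by ring
        _ ≤ q * M := Nat.mul_le_mul_left _ this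
  simpa using Finset.card_le_card h

theorem exists_tendsto_card_blockClass (hm₂ : 2 ≤ m₂) (hm : m₂ < m₁) (hq : 2 ≤ q) (p P : ℕ) :
    ∃ t, Tendsto (fun n : ℕ => ((blockClass q n (squareHeight m₁ m₂ n) p P).card : ℝ) / n)
      atTop (𝓝 t) := by
  have hL := tendsto_squareHeight_div (m₁ := m₁) (m₂ := m₂) hm₂ hm
  have hn : Tendsto (fun n : ℕ => ((n : ℕ) : ℝ) / n) atTop (𝓝 1) := by
    refine tendsto_const_nhds.congr' ?_
    filter_upwards [eventually_gt_atTop 0] with n hn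
    rw [div_self (by positivity)]
  rcases P with _ | P
  · refine ⟨0, tendsto_const_nhds.congr fun n => ?_⟩
    have : blockClass q n (squareHeight m₁ m₂ n) p 0 = ∅ := by
      refine Finset.filter_eq_empty_iff.2 fun i hi h => ?_
      rw [mem_blockIdx] at hi
      have := (orbitCount_le_iff hq hi.1).1 h.2.le
      simp at this
      omega
    simp [this]
  · have hmax : ∀ {x y : ℕ → ℕ} {s t : ℝ}, Tendsto (fun n => (x n : ℝ) / n) atTop (𝓝 s) →
        Tendsto (fun n => (y n : ℝ) / n) atTop (𝓝 t) →
        Tendsto (fun n => ((max (x n) (y n) : ℕ) : ℝ) / n) atTop (𝓝 (max s t)) :=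
      fun hx hy => (hx.max hy).congr fun n => by
        rw [Nat.cast_max, max_div_div_right n.cast_nonneg]
    have hmin : ∀ {x y : ℕ → ℕ} {s t : ℝ}, Tendsto (fun n => (x n : ℝ) / n) atTop (𝓝 s) →
        Tendsto (fun n => (y n : ℝ) / n) atTop (𝓝 t) →
        Tendsto (fun n => ((min (x n) (y n) : ℕ) : ℝ) / n) atTop (𝓝 (min s t)) :=
      fun hx hy => (hx.min hy).congr fun n => by
        rw [Nat.cast_min, min_div_div_right n.cast_nonneg]
    have hif : ∃ s, Tendsto (fun n => ((if p = 0 then squareHeight m₁ m₂ n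
        else n / q ^ (p - 1) : ℕ) : ℝ) / n) atTop (𝓝 s) := by
      split_ifs
      · exact ⟨_, hL⟩
      · exact ⟨_, tendsto_natCast_natDiv_div hn _⟩
    obtain ⟨s, hs⟩ := hif
    have h1 := tendsto_card_blockIdx (q := q) (hmin hs (tendsto_natCast_natDiv_div hL (q ^ P)))
    have h2 := tendsto_card_blockIdx (q := q) (hmax (tendsto_natCast_natDiv_div hn (q ^ p))
      (tendsto_natCast_natDiv_div hL (q ^ (P + 1))))
    refine ⟨_, ((h1.sub h2).max (tendsto_const_nhds (x := (0 : ℝ)))).congr fun n => ?_⟩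
    rw [card_blockClass hq, ← sub_div, ← zero_div (n : ℝ), max_div_div_right n.cast_nonneg]
    congr 1
    rcases le_total (blockIdx q (min (if p = 0 then squareHeight m₁ m₂ n else n / q ^ (p - 1))
        (squareHeight m₁ m₂ n / q ^ P))).card
      (blockIdx q (max (n / q ^ p) (squareHeight m₁ m₂ n / q ^ (P + 1)))).card with h | h
    · rw [Nat.sub_eq_zero_of_le h, max_eq_right (by rw [sub_nonpos]; exact_mod_cast h),
        Nat.cast_zero]
    · rw [Nat.cast_sub h, max_eq_left (by rw [sub_nonneg]; exact_mod_cast h)]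

/-- Grouped by classes, the sum is a series of `f p P` times class densities. For each `P` there are
`P + 1` values of `p`, each term being at most `P * Λ` times a multiple of `q ^ (-P)`, so dominated
convergence applies. -/
theorem exists_tendsto_sum_blockIdx_div (hm₂ : 2 ≤ m₂) (hm : m₂ < m₁) (hq : 2 ≤ q)
    (f : ℕ → ℕ → ℝ) {Λ : ℝ} (hf : ∀ p P, p ≤ P → |f p P| ≤ P * Λ) :
    ∃ h, Tendsto (fun n : ℕ => (∑ i ∈ blockIdx q (squareHeight m₁ m₂ n),
      f (orbitCount q n i) (orbitCount q (squareHeight m₁ m₂ n) i)) / n) atTop (𝓝 h) := by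
  have hγ := gammaRatio_pos hm₂ hm
  choose t ht using exists_tendsto_card_blockClass (m₁ := m₁) (m₂ := m₂) hm₂ hm hq
  have hΛ : 0 ≤ Λ := by
    have := (abs_nonneg _).trans (hf 0 1 zero_le_one)
    simpa using this
  set C := 1 / gammaRatio m₁ m₂ + 1
  have hq1 : (1 : ℝ) < q := by exact_mod_cast (by omega : 1 < q)
  have hsum : Summable fun P : ℕ => ((P : ℝ) + 1) * ((P * Λ) * (q * C / q ^ P)) := by
    have hr : ‖(q : ℝ)⁻¹‖ < 1 := by
      rw [Real.norm_of_nonneg (by positivity)]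
      exact inv_lt_one_of_one_lt₀ hq1
    have := ((summable_pow_mul_geometric_of_norm_lt_one 2 hr).add
      (summable_pow_mul_geometric_of_norm_lt_one 1 hr)).mul_left (Λ * (q * C))
    refine this.congr fun P => ?_
    rw [inv_pow]
    field_simp
  refine ⟨_, (tendsto_tsum_of_dominated_convergence
    (f := fun (n P : ℕ) => ∑ p ∈ Finset.range (P + 1),
      f p P * ((blockClass q n (squareHeight m₁ m₂ n) p P).card / n)) hsum
      (fun P => tendsto_finsetSum _ fun p _ => (ht p P).const_mul (f p P)) ?_).congr fun n => ?_⟩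
  · filter_upwards [eventually_ge_atTop 1] with n hn P
    have hn0 : (0 : ℝ) < n := by exact_mod_cast hn
    refine (norm_sum_le _ _).trans ?_
    have : ((P : ℝ) + 1) = ((Finset.range (P + 1)).card : ℝ) := by simp
    rw [this, ← nsmul_eq_mul]
    refine Finset.sum_le_card_nsmul _ _ _ fun p hp => ?_
    rw [norm_mul, Real.norm_eq_abs, Real.norm_of_nonneg (by positivity)]
    refine mul_le_mul (hf p P (by simpa [Nat.lt_succ_iff] using hp)) ?_ (by positivity)
      (by positivity)
    have h1 : ((blockClass q n (squareHeight m₁ m₂ n) p P).card : ℝ) ≤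
        q * squareHeight m₁ m₂ n / q ^ P := by
      refine le_trans (Nat.cast_le.2 (card_blockClass_le hq _ _ _ _)) ?_
      refine Nat.cast_div_le.trans ?_
      push_cast
      rfl
    rw [div_le_iff₀ hn0]
    refine h1.trans ?_
    rw [div_mul_eq_mul_div, mul_assoc]
    gcongr
    exact squareHeight_le hm₂ hm hn
  · rw [Finset.sum_div]
    set M := squareHeight m₁ m₂ n
    have hmaps : ∀ i ∈ blockIdx q M, orbitCount q M i ∈ Finset.range (M + 1) := by
      intro i hi
      rw [mem_blockIdx] at hi
      rw [Finset.mem_range, Nat.lt_succ_iff, orbitCount_le_iff hq hi.1]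
      exact (Nat.lt_pow_self (by omega)).trans_le (Nat.le_mul_of_pos_left _ hi.1)
    -- No orbit count exceeds `M`, so the series stops there.
    rw [← Finset.sum_fiberwise_of_maps_to hmaps, tsum_eq_sum (s := Finset.range (M + 1))]
    · refine Finset.sum_congr rfl fun P _ => ?_
      have hmaps' : ∀ i ∈ (blockIdx q M).filter (fun i => orbitCount q M i = P),
          orbitCount q n i ∈ Finset.range (P + 1) := by
        intro i hi
        rw [Finset.mem_filter] at hi
        rw [Finset.mem_range, Nat.lt_succ_iff, ← hi.2]
        exact orbitCount_mono (le_squareHeight hm₂ hm n) i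
      rw [← Finset.sum_fiberwise_of_maps_to hmaps']
      refine Finset.sum_congr rfl fun p _ => ?_
      rw [Finset.filter_filter, blockClass]
      have : ((blockIdx q M).filter fun i => orbitCount q M i = P ∧ orbitCount q n i = p) =
          (blockIdx q M).filter fun i => orbitCount q n i = p ∧ orbitCount q M i = P :=
        Finset.filter_congr fun _ _ => and_comm
      rw [this, Finset.sum_congr rfl (g := fun _ => f p P / n), Finset.sum_const, nsmul_eq_mul]
      · ring
      · intro i hi
        rw [Finset.mem_filter] at hi
        rw [hi.2.1, hi.2.2]
    · intro P hP
      refine Finset.sum_eq_zero fun p _ => ?_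
      have : blockClass q n M p P = ∅ := by
        refine Finset.filter_eq_empty_iff.2 fun i hi h => hP ?_
        rw [← h.2]
        exact hmaps i hi
      simp [this]

theorem exists_tendsto_log_squareCount (hm₂ : 2 ≤ m₂) (hm : m₂ < m₁) (hq : 2 ≤ q)
    {Ω : Set (SymSeq m₁ m₂)} (hne : Ω.Nonempty) :
    ∃ h, Tendsto (fun n : ℕ => Real.log (squareCount q Ω n) / n) atTop (𝓝 h) := by
  obtain ⟨h, hh⟩ := exists_tendsto_sum_blockIdx_div (m₁ := m₁) (m₂ := m₂) hm₂ hm hq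
    (fun p P => Real.log (pref Ω p (P - p)).ncard) (Λ := Real.log (m₁ * m₂)) fun p P hpP => by
      have h1 : (1 : ℝ) ≤ (pref Ω p (P - p)).ncard := by
        exact_mod_cast ncard_pref_pos hne p (P - p)
      rw [abs_of_nonneg (Real.log_nonneg h1), ← Real.log_pow]
      refine Real.log_le_log (by linarith) ?_
      have h2 : (pref Ω p (P - p)).ncard ≤ (m₁ * m₂) ^ P := by
        refine (ncard_pref_le Ω p (P - p)).trans ?_
        calc (m₁ * m₂) ^ p * m₂ ^ (P - p) ≤ (m₁ * m₂) ^ p * (m₁ * m₂) ^ (P - p) := by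
              gcongr
              exact Nat.le_mul_of_pos_left _ (by omega)
          _ = (m₁ * m₂) ^ P := by rw [← pow_add, Nat.add_sub_cancel' hpP]
      exact_mod_cast h2
  refine ⟨h, hh.congr fun n => ?_⟩
  rw [squareCount, Nat.cast_prod, Real.log_prod fun i _ => by
    exact_mod_cast (ncard_pref_pos hne _ _).ne']
  rfl

end Limit

/-! ### Lower bound for the Hausdorff dimension under the four conditions. -/

section LowerBound

variable {m₁ m₂ q j : ℕ}

theorem lt_squareHeight_iff (hm₂ : 2 ≤ m₂) (hm : m₂ < m₁) {n k : ℕ} :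
    k < squareHeight m₁ m₂ n ↔ gammaRatio m₁ m₂ * k < n := by
  rw [squareHeight, Nat.lt_ceil, lt_div_iff₀ (gammaRatio_pos hm₂ hm), mul_comm]

/-- If `p` is the count up to `n`, then `n + 1 ≤ i * q ^ p`. As `1 ≤ 1 / γ`, the ceiling is
absorbed: `L < n / γ + 1 ≤ (n + 1) / γ`, and `1 / γ < q ^ (j + 1)` concludes. -/
theorem orbitCount_squareHeight_le (hm₂ : 2 ≤ m₂) (hm : m₂ < m₁) (hq : 2 ≤ q)
    (hj' : 1 / gammaRatio m₁ m₂ < (q : ℝ) ^ (j + 1)) {n i : ℕ} (hi : 1 ≤ i) :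
    orbitCount q (squareHeight m₁ m₂ n) i ≤ orbitCount q n i + (j + 1) := by
  have hγ := gammaRatio_pos hm₂ hm
  have h1 : n < i * q ^ orbitCount q n i := (orbitCount_le_iff hq hi).1 le_rfl
  rw [orbitCount_le_iff hq hi]
  have h2 : (squareHeight m₁ m₂ n : ℝ) < n / gammaRatio m₁ m₂ + 1 :=
    Nat.ceil_lt_add_one (by positivity)
  have h3 : ((n : ℝ) + 1) ≤ i * q ^ orbitCount q n i := by exact_mod_cast h1
  have h4 : 1 ≤ 1 / gammaRatio m₁ m₂ := by
    rw [le_div_iff₀ hγ]; linarith [gammaRatio_lt_one hm₂ hm]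
  have : (squareHeight m₁ m₂ n : ℝ) < i * q ^ (orbitCount q n i + (j + 1)) := by
    calc (squareHeight m₁ m₂ n : ℝ) < n / gammaRatio m₁ m₂ + 1 := h2
      _ ≤ (n + 1) * (1 / gammaRatio m₁ m₂) := by rw [add_mul, mul_one_div, one_mul]; gcongr
      _ ≤ (i * q ^ orbitCount q n i) * q ^ (j + 1) := by gcongr
      _ = _ := by rw [pow_add _ _ (j + 1)]; ring
  exact_mod_cast this

/-- The last orbit element `i * q ^ (p - 1) ≤ n`, multiplied by `q ^ j ≤ 1 / γ`, stays below the
height. This needs `p ≥ 1`. -/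
theorem le_orbitCount_squareHeight (hq : 2 ≤ q)
    (hj : (q : ℝ) ^ j ≤ 1 / gammaRatio m₁ m₂) {n i : ℕ} (hi : 1 ≤ i)
    (hp : 1 ≤ orbitCount q n i) :
    orbitCount q n i + j ≤ orbitCount q (squareHeight m₁ m₂ n) i := by
  obtain ⟨p, hp'⟩ := Nat.exists_eq_add_of_le' hp
  have h1 : i * q ^ p ≤ n := (lt_orbitCount_iff hq hi).1 (by omega)
  have h2 : p + j < orbitCount q (squareHeight m₁ m₂ n) i := by
    rw [lt_orbitCount_iff hq hi]
    have h3 : (n : ℝ) / gammaRatio m₁ m₂ ≤ squareHeight m₁ m₂ n := Nat.le_ceil _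
    have h4 : (i : ℝ) * q ^ p ≤ n := by exact_mod_cast h1
    have : (i : ℝ) * q ^ (p + j) ≤ squareHeight m₁ m₂ n := by
      calc (i : ℝ) * q ^ (p + j) = (i * q ^ p) * q ^ j := by ring
        _ ≤ n * (1 / gammaRatio m₁ m₂) := by gcongr
        _ ≤ _ := by rwa [mul_one_div]
    exact_mod_cast this
  omega

theorem orbitCount_le_self (hq : 2 ≤ q) (x : ℕ) {i : ℕ} (hi : 1 ≤ i) : orbitCount q x i ≤ x := by
  rw [orbitCount_le_iff hq hi]
  exact (Nat.lt_pow_self (by omega)).trans_le (Nat.le_mul_of_pos_left _ hi)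

/-- The conditions link the occurring sizes: `(0, l)` to `(0, l + 1)` up to `(0, j + 1)`, then `(p,
j + 1)` to `(p + 1, j)`, and `(p, j)` to `(p + 1, j)`. Uniform refinement composes along these
links. -/
theorem uniformlyRefines_of_hasUniformFollowers {Ω : Set (SymSeq m₁ m₂)}
    (hU : HasUniformFollowers Ω j) {p l k : ℕ} (hl : l ≤ j + 1) (hp : 1 ≤ p → j ≤ l)
    (hk : p + l + 1 ≤ k) : UniformlyRefines Ω (word p l) (word k j) := by
  obtain ⟨h1, h2, h3⟩ := hasUniformFollowers_iff.1 hU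
  have hA : ∀ a, 1 ≤ a → ∀ b, a ≤ b → UniformlyRefines Ω (word a j) (word b j) := by
    intro a ha b hab
    induction b, hab using Nat.le_induction with
    | base => exact UniformlyRefines.refl _ _
    | succ b hab ih =>
      exact ih.trans (word_factorsThrough (by omega) (by omega))
        (word_factorsThrough (by omega) (by omega)) (finite_image_word _ _ _)
        (h1 b (ha.trans hab))
  have hB : ∀ a b, a + 1 ≤ b → UniformlyRefines Ω (word a (j + 1)) (word b j) := fun a b hab =>
    (h3 a).trans (word_factorsThrough (by omega) (by omega))
      (word_factorsThrough (by omega) (by omega)) (finite_image_word _ _ _)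
      (hA (a + 1) (by omega) b hab)
  rcases Nat.eq_zero_or_pos p with rfl | hp0
  · rcases Nat.eq_zero_or_pos l with rfl | hl0
    -- The empty word has the single fibre `Ω`, so uniformity is automatic.
    · exact ⟨_, fun s hs => congrArg ncard (congrArg (image _) (by
        ext t; simp [word] : {t ∈ Ω | t.word 0 0 = s.word 0 0} = Ω))⟩
    · have hC : ∀ d l, 1 ≤ l → l + d = j + 1 → UniformlyRefines Ω (word 0 l) (word 0 (j + 1)) := by
        intro d
        induction d with
        | zero => rintro l - rfl; exact UniformlyRefines.refl _ _
        | succ d ih =>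
          intro l hl hd
          exact (h2 l hl (by omega)).trans (word_factorsThrough (by omega) (by omega))
            (word_factorsThrough (by omega) (by omega)) (finite_image_word _ _ _)
            (ih (l + 1) (by omega) (by omega))
      exact (hC (j + 1 - l) l hl0 (by omega)).trans (word_factorsThrough (by omega) (by omega))
        (word_factorsThrough (by omega) (by omega)) (finite_image_word _ _ _) (hB 0 k (by omega))
  · rcases (show l = j ∨ l = j + 1 by have := hp hp0; omega) with rfl | rfl
    · exact hA p hp0 k (by omega)
    · exact hB p k (by omega)

/-- A finite form of the mass distribution principle. Choose words of size `(K, j)` uniformly and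
independently in the orbits `i ≤ H`. By uniform refinement a ball of scale `n k` has probability
exactly `1 / squareCount q Ω (n k)`, and a cover has total probability at least `1`. -/
theorem one_le_sum_inv_squareCount (hm₂ : 2 ≤ m₂) (hm : m₂ < m₁) (hq : 2 ≤ q)
    (hj : (q : ℝ) ^ j ≤ 1 / gammaRatio m₁ m₂) (hj' : 1 / gammaRatio m₁ m₂ < (q : ℝ) ^ (j + 1))
    {Ω : Set (SymSeq m₁ m₂)} (hne : Ω.Nonempty) (hU : HasUniformFollowers Ω j) {ι : Type*}
    (F : Finset ι) (z : ι → SymSeq m₁ m₂) (hz : ∀ k ∈ F, z k ∈ multInvSet q Ω) (n : ι → ℕ)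
    (hF : multInvSet q Ω ⊆ ⋃ k ∈ F, Metric.closedBall (z k) ((m₁ : ℝ) ^ n k)⁻¹) :
    (1 : ℝ) ≤ ∑ k ∈ F, (squareCount q Ω (n k) : ℝ)⁻¹ := by
  classical
  set M := F.sup n
  have hnM : ∀ k ∈ F, n k ≤ M := fun k hk => Finset.le_sup hk
  set H := squareHeight m₁ m₂ M
  have hLM : ∀ k ∈ F, squareHeight m₁ m₂ (n k) ≤ H := fun k hk =>
    squareHeight_mono hm₂ hm (hnM k hk)
  -- Long enough to extend every word fixed by one of the balls, as these have `p + l ≤ H`.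
  set K := H + 1
  set A := (pref Ω K j).ncard
  have hA : 0 < A := ncard_pref_pos hne _ _
  have hfin : ∀ P : SymSeq m₁ m₂ → Prop, (word K j '' {t ∈ Ω | P t}).Finite := fun P =>
    (finite_image_word Ω K j).subset (image_mono fun t ht => ht.1)
  let c : ι → ℕ → ℕ × ℕ := fun k i => blockSize q m₁ m₂ (n k) i
  -- The choices of long words, one for each orbit, that are compatible with the `k`-th ball.
  let T : (k : ι) → Finset (blockIdx q H → GenWord m₁ m₂) := fun k =>
    Fintype.piFinset fun i : blockIdx q H => (hfin fun t =>
      t.word (c k i).1 (c k i).2 = ((z k).orbit q i).word (c k i).1 (c k i).2).toFinset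
  have hc0 : ∀ k, ∀ i ∈ blockIdx q H, i ∉ blockIdx q (squareHeight m₁ m₂ (n k)) →
      c k i = (0, 0) := by
    intro k i hi hi'
    rw [mem_blockIdx] at hi hi'
    have hlt : squareHeight m₁ m₂ (n k) < i := by
      by_contra h
      exact hi' ⟨hi.1, by omega, hi.2.2⟩
    have h1 : orbitCount q (squareHeight m₁ m₂ (n k)) i ≤ 0 := by
      rw [orbitCount_le_iff hq hi.1]; simpa using hlt
    have h2 := orbitCount_mono (q := q) (le_squareHeight hm₂ hm (n k)) i
    simp only [c, blockSize, Prod.mk.injEq]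
    omega
  have hcard : ∀ k ∈ F, (T k).card * squareCount q Ω (n k) = A ^ (blockIdx q H).card := by
    intro k hk
    have h1 : squareCount q Ω (n k) =
        ∏ i ∈ blockIdx q H, (pref Ω (c k i).1 (c k i).2).ncard := by
      refine Finset.prod_subset (fun i hi => ?_) fun i hi hi' => ?_
      · rw [mem_blockIdx] at hi ⊢
        exact ⟨hi.1, hi.2.1.trans (hLM k hk), hi.2.2⟩
      · change (pref Ω (c k i).1 (c k i).2).ncard = 1
        rw [hc0 k i hi hi', ncard_eq_one]
        refine ⟨([], []), ?_⟩
        rw [pref_eq_image]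
        ext u
        simp only [word, List.range_zero, List.map_nil, mem_image, mem_singleton_iff]
        constructor
        · rintro ⟨_, _, rfl⟩; rfl
        · rintro rfl; exact ⟨_, hne.some_mem, rfl⟩
    rw [h1, Fintype.card_piFinset, ← Finset.prod_coe_sort (blockIdx q H)
      fun i => (pref Ω (c k i).1 (c k i).2).ncard, ← Finset.prod_mul_distrib]
    rw [Finset.prod_congr rfl (g := fun _ => A)]
    · simp
    · rintro ⟨i, hi⟩ -
      have hi' := mem_blockIdx.1 hi
      have hmono := orbitCount_mono (q := q) (le_squareHeight hm₂ hm (n k)) i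
      have h2 := orbitCount_squareHeight_le hm₂ hm hq hj' (n := n k) hi'.1
      have h3 := le_orbitCount_squareHeight hq hj (n := n k) hi'.1
      have h4 := (orbitCount_mono (q := q) (hLM k hk) i).trans (orbitCount_le_self hq H hi'.1)
      have hs : (c k i).1 + (c k i).2 ≤ H := by
        simp only [c, blockSize]; omega
      have hunif : UniformlyRefines Ω (word (c k i).1 (c k i).2) (word K j) := by
        refine uniformlyRefines_of_hasUniformFollowers hU ?_ ?_ ?_ <;>
          simp only [c, blockSize, K] at * <;> omega
      have := hunif.ncard_mul (word_factorsThrough (by omega) (by omega)) (finite_image_word Ω K j)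
        (orbit_mem Ω (hz k hk) ⟨i, hi⟩)
      rw [← ncard_eq_toFinset_card _ (hfin _), pref_eq_image, this, ← pref_eq_image]
  have hcover : Fintype.piFinset (fun _ : blockIdx q H => (finite_pref Ω K j).toFinset) ⊆
      F.biUnion T := by
    intro v hv
    simp only [Fintype.mem_piFinset, Finite.mem_toFinset, pref_eq_image] at hv
    choose s hs hsv using hv
    obtain ⟨w, hw, hws⟩ := exists_mem_multInvSet_orbit_eq hq hne s hs
    obtain ⟨k, hk, hwk⟩ := mem_iUnion₂.1 (hF hw)
    rw [Finset.mem_biUnion]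
    refine ⟨k, hk, ?_⟩
    simp only [T, Fintype.mem_piFinset, Finite.mem_toFinset]
    intro i
    refine ⟨s i, ⟨hs i, ?_⟩, hsv i⟩
    rw [← hws i]
    by_cases hi : (i : ℕ) ∈ blockIdx q (squareHeight m₁ m₂ (n k))
    · exact (SymSeq.dist_le_iff_forall_word hm₂ hm hq _ _ _).1 (Metric.mem_closedBall.1 hwk) i hi
    · rw [hc0 k i i.2 hi]
      simp [word]
  have htot : A ^ (blockIdx q H).card ≤ ∑ k ∈ F, (T k).card := by
    refine le_trans (le_of_eq ?_) ((Finset.card_le_card hcover).trans Finset.card_biUnion_le)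
    rw [Fintype.card_piFinset]
    simp only [← ncard_eq_toFinset_card _ (finite_pref Ω K j)]
    simp [A]
  have hpos : (0 : ℝ) < (A : ℝ) ^ (blockIdx q H).card := by positivity
  have htot' : (A : ℝ) ^ (blockIdx q H).card ≤ ∑ k ∈ F, ((T k).card : ℝ) := by exact_mod_cast htot
  have : ∑ k ∈ F, ((T k).card : ℝ) =
      (A : ℝ) ^ (blockIdx q H).card * ∑ k ∈ F, (squareCount q Ω (n k) : ℝ)⁻¹ := by
    rw [Finset.mul_sum]
    refine Finset.sum_congr rfl fun k hk => ?_
    have h0 : (squareCount q Ω (n k) : ℝ) ≠ 0 := by exact_mod_cast (squareCount_pos hne _).ne'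
    rw [eq_mul_inv_iff_mul_eq₀ h0]
    exact_mod_cast hcard k hk
  rw [this] at htot'
  exact le_of_mul_le_mul_left (by rwa [mul_one]) hpos

theorem isOpen_closedBall_inv_pow (hm₂ : 2 ≤ m₂) (hm : m₂ < m₁) (z : SymSeq m₁ m₂) (n : ℕ) :
    IsOpen (Metric.closedBall z ((m₁ : ℝ) ^ n)⁻¹) := by
  rw [isOpen_iff_mem_nhds]
  intro w hw
  filter_upwards [Metric.closedBall_mem_nhds w (inv_pow_pos_of_pos (by omega : 0 < m₁) n)]
    with v hv
  -- The code for any `q` describes closeness; `le_rfl` selects `q = 2`.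
  rw [Metric.mem_closedBall, ← squareCode_eq_iff hm₂ hm le_rfl] at *
  exact hv.trans hw

/-- Rounding a diameter up to a power of `m⁻¹` costs a factor at most `m`. The error `η` is there
for diameter zero, which has no smallest such power above it. -/
theorem exists_le_inv_pow {m : ℕ} (hm : 1 < m) {s : ℝ} (hs : 0 < s) {a η : ℝ} (ha : 0 ≤ a)
    (ha1 : a ≤ 1) (hη : 0 < η) :
    ∃ n : ℕ, a ≤ ((m : ℝ) ^ n)⁻¹ ∧ (((m : ℝ) ^ n)⁻¹) ^ s ≤ (m : ℝ) ^ s * a ^ s + η := by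
  have hm1 : (1 : ℝ) < m := by exact_mod_cast hm
  rcases ha.eq_or_lt with rfl | ha0
  · obtain ⟨n, hn⟩ := exists_inv_pow_lt hm (Real.rpow_pos_of_pos hη s⁻¹)
    refine ⟨n, by positivity, ?_⟩
    have := Real.rpow_le_rpow (by positivity) hn.le hs.le
    rw [Real.rpow_inv_rpow hη.le hs.ne'] at this
    have h0 : 0 ≤ (m : ℝ) ^ s * 0 ^ s := by positivity
    linarith
  · obtain ⟨n, h1, h2⟩ := exists_nat_pow_near ((one_le_inv₀ ha0).2 ha1) hm1
    refine ⟨n, (le_inv_comm₀ ha0 (by positivity)).2 h1, ?_⟩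
    have h3 : ((m : ℝ) ^ n)⁻¹ ≤ m * a := by
      rw [inv_lt_comm₀ ha0 (by positivity), pow_succ, mul_inv] at h2
      rw [← div_le_iff₀' (by positivity), div_eq_mul_inv]
      exact h2.le
    have := Real.rpow_le_rpow (by positivity) h3 hs.le
    rw [Real.mul_rpow (by positivity) ha] at this
    linarith

/-- Since `s * log m₁ < h`, the bound holds with constant one for large `n`; `C` absorbs the
remaining scales, where the count is at least `1`. -/
theorem exists_inv_squareCount_le (hm : 1 < m₁)
    {Ω : Set (SymSeq m₁ m₂)} (hne : Ω.Nonempty) {h : ℝ}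
    (hh : Tendsto (fun n : ℕ => Real.log (squareCount q Ω n) / n) atTop (𝓝 h))
    {s : ℝ} (hs0 : 0 < s) (hs : s < h / Real.log m₁) :
    ∃ C > 0, ∀ n, (squareCount q Ω n : ℝ)⁻¹ ≤ C * (((m₁ : ℝ) ^ n)⁻¹) ^ s := by
  have hm1 : (1 : ℝ) < m₁ := by exact_mod_cast hm
  have hlog : 0 < Real.log m₁ := Real.log_pos hm1
  rw [lt_div_iff₀ hlog] at hs
  obtain ⟨n₀, hn₀⟩ := eventually_atTop.1 ((hh.eventually (lt_mem_nhds hs)).and (eventually_gt_atTop 0))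
  have hN : ∀ n, (1 : ℝ) ≤ squareCount q Ω n := fun n => by exact_mod_cast squareCount_pos hne n
  have hr : ∀ n : ℕ, (((m₁ : ℝ) ^ n)⁻¹) ^ s = Real.exp (-(n * (s * Real.log m₁))) := by
    intro n
    rw [Real.rpow_def_of_pos (by positivity), Real.log_inv, Real.log_pow]
    congr 1; ring
  refine ⟨Real.exp (n₀ * (s * Real.log m₁)), Real.exp_pos _, fun n => ?_⟩
  rw [hr, ← Real.exp_add]
  rcases le_total n₀ n with h1 | h1
  · obtain ⟨h2, h3⟩ := hn₀ n h1
    have h4 : (0 : ℝ) < n := by exact_mod_cast h3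
    rw [lt_div_iff₀ h4] at h2
    rw [← Real.exp_log (lt_of_lt_of_le one_pos (hN n)), ← Real.exp_neg, Real.exp_le_exp]
    have : 0 ≤ n₀ * (s * Real.log m₁) := by positivity
    linarith
  · refine (inv_le_one_of_one_le₀ (hN n)).trans (Real.one_le_exp ?_)
    have : (n : ℝ) * (s * Real.log m₁) ≤ n₀ * (s * Real.log m₁) := by
      gcongr
    linarith

/-- If the `s`-dimensional measure vanished, a cover with small sum of `diam ^ s` could be enlarged
to balls of radii `m₁ ^ (-n)`. These are open, so compactness leaves finitely many, contradicting
`one_le_sum_inv_squareCount`. -/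
theorem le_dimH_multInvSet (hm₂ : 2 ≤ m₂) (hm : m₂ < m₁) (hq : 2 ≤ q)
    (hj : (q : ℝ) ^ j ≤ 1 / gammaRatio m₁ m₂) (hj' : 1 / gammaRatio m₁ m₂ < (q : ℝ) ^ (j + 1))
    {Ω : Set (SymSeq m₁ m₂)} (hΩ : IsClosed Ω) (hne : Ω.Nonempty) (hU : HasUniformFollowers Ω j)
    {h : ℝ} (hh : Tendsto (fun n : ℕ => Real.log (squareCount q Ω n) / n) atTop (𝓝 h))
    {s : ℝ≥0} (hs0 : 0 < s) (hs : s < h / Real.log m₁) : (s : ℝ≥0∞) ≤ dimH (multInvSet q Ω) := by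
  borelize (SymSeq m₁ m₂)
  have hs0' : (0 : ℝ) < s := hs0
  have hm1 : (1 : ℝ) < m₁ := by exact_mod_cast (by omega : 1 < m₁)
  obtain ⟨C, hC, hCn⟩ := exists_inv_squareCount_le (by omega) hne hh hs0' hs
  refine le_dimH_of_hausdorffMeasure_ne_zero fun h0 => ?_
  rw [MeasureTheory.Measure.hausdorffMeasure_apply] at h0
  set ε : ℝ := (2 * C * ((m₁ : ℝ) ^ (s : ℝ) + 1))⁻¹ with hε
  have hε0 : 0 < ε := by positivity
  have h1 := (iSup₂_le_iff.1 h0.le) 1 one_pos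
  obtain ⟨t, h2⟩ := iInf_lt_iff.1 (lt_of_le_of_lt h1 (ENNReal.ofReal_pos.2 hε0))
  obtain ⟨ht, h2⟩ := iInf_lt_iff.1 h2
  obtain ⟨hd, h2⟩ := iInf_lt_iff.1 h2
  have hd' : ∀ k, (Metric.ediam (t k)).toReal ≤ 1 := fun k =>
    ENNReal.toReal_le_of_le_ofReal zero_le_one (by simpa using hd k)
  have hη : ∀ k : ℕ, 0 < ε / 2 / 2 ^ k := fun k => by positivity
  choose n hn1 hn2 using fun k : ℕ => exists_le_inv_pow (by omega : 1 < m₁) hs0'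
    (ENNReal.toReal_nonneg (a := Metric.ediam (t k))) (hd' k) (hη k)
  -- Only pieces that meet `X_Ω` are kept, so that the balls can be centred in `X_Ω`.
  let ι := {k : ℕ // (t k ∩ multInvSet q Ω).Nonempty}
  choose z hz using fun k : ι => k.2
  obtain ⟨F, hF⟩ := (isCompact_multInvSet hm₂ hm q hΩ).elim_finite_subcover
    (fun k : ι => Metric.closedBall (z k) ((m₁ : ℝ) ^ n k)⁻¹)
    (fun k => isOpen_closedBall_inv_pow hm₂ hm _ _) (fun w hw => by
      obtain ⟨k, hk⟩ := mem_iUnion.1 (ht hw)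
      refine mem_iUnion.2 ⟨⟨k, w, hk, hw⟩, ?_⟩
      rw [Metric.mem_closedBall]
      refine le_trans ?_ (hn1 k)
      rw [dist_edist]
      exact ENNReal.toReal_mono (ne_top_of_le_ne_top ENNReal.one_ne_top (hd k))
        (Metric.edist_le_ediam_of_mem hk (hz ⟨k, w, hk, hw⟩).1))
  have h3 := one_le_sum_inv_squareCount hm₂ hm hq hj hj' hne hU F z (fun k _ => (hz k).2)
    (fun k => n k) hF
  have h4 : ∑ k ∈ F, (Metric.ediam (t k)).toReal ^ (s : ℝ) < ε := by
    have h5 : ∑ k ∈ F, Metric.ediam (t k) ^ (s : ℝ) < ENNReal.ofReal ε := by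
      refine lt_of_le_of_lt ?_ h2
      calc ∑ k ∈ F, Metric.ediam (t k) ^ (s : ℝ)
          ≤ ∑ k ∈ F, ⨆ _ : (t k).Nonempty, Metric.ediam (t k) ^ (s : ℝ) :=
            Finset.sum_le_sum fun k _ => le_iSup (fun _ : (t k).Nonempty =>
              Metric.ediam (t k) ^ (s : ℝ)) ⟨_, (hz k).1⟩
        _ = ∑ k ∈ F.map (Function.Embedding.subtype _),
              ⨆ _ : (t k).Nonempty, Metric.ediam (t k) ^ (s : ℝ) := by
            rw [Finset.sum_map]; rfl
        _ ≤ _ := ENNReal.sum_le_tsum _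
    have h6 := (ENNReal.toReal_lt_toReal (ne_top_of_lt h5) ENNReal.ofReal_ne_top).2 h5
    rw [ENNReal.toReal_ofReal hε0.le, ENNReal.toReal_sum] at h6
    · simpa only [ENNReal.toReal_rpow] using h6
    · intro k _
      exact ENNReal.rpow_ne_top_of_nonneg s.2 (ne_top_of_le_ne_top ENNReal.one_ne_top (hd k))
  have h7 : ∑ k ∈ F, ε / 2 / 2 ^ (k : ℕ) ≤ ε := by
    calc ∑ k ∈ F, ε / 2 / 2 ^ (k : ℕ)
        = ∑ k ∈ F.map (Function.Embedding.subtype _), ε / 2 / 2 ^ k := by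
          rw [Finset.sum_map]; rfl
      _ ≤ ∑' k : ℕ, ε / 2 / 2 ^ k := (summable_geometric_two' ε).sum_le_tsum _
          fun k _ => (hη k).le
      _ = ε := tsum_geometric_two' ε
  have h8 : ∑ k ∈ F, (squareCount q Ω (n k) : ℝ)⁻¹ ≤ C * ((m₁ : ℝ) ^ (s : ℝ) *
      ∑ k ∈ F, (Metric.ediam (t k)).toReal ^ (s : ℝ) + ∑ k ∈ F, ε / 2 / 2 ^ (k : ℕ)) := by
    rw [Finset.mul_sum, ← Finset.sum_add_distrib, Finset.mul_sum]
    refine Finset.sum_le_sum fun k _ => (hCn _).trans ?_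
    gcongr
    exact hn2 k
  have h9 : C * ((m₁ : ℝ) ^ (s : ℝ) * ∑ k ∈ F, (Metric.ediam (t k)).toReal ^ (s : ℝ) +
      ∑ k ∈ F, ε / 2 / 2 ^ (k : ℕ)) ≤ C * ((m₁ : ℝ) ^ (s : ℝ) * ε + ε) := by
    gcongr
  have h10 : C * ((m₁ : ℝ) ^ (s : ℝ) * ε + ε) = 1 / 2 := by
    rw [hε]
    field_simp
  linarith

end LowerBound

/-! ### Upper bounds from covers at infinitely many scales. -/

section UpperBound

variable {m₁ m₂ q : ℕ}

theorem summable_squareCount_mul (hm : 1 < m₁) {Ω : Set (SymSeq m₁ m₂)} (hne : Ω.Nonempty) {h : ℝ}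
    (hh : Tendsto (fun n : ℕ => Real.log (squareCount q Ω n) / n) atTop (𝓝 h)) {δ s : ℝ}
    (hs : (h - δ) / Real.log m₁ < s) :
    Summable fun n : ℕ => squareCount q Ω n * Real.exp (-(δ * n)) * (((m₁ : ℝ) ^ n)⁻¹) ^ s := by
  have hm1 : (1 : ℝ) < m₁ := by exact_mod_cast hm
  have hlog : 0 < Real.log m₁ := Real.log_pos hm1
  rw [div_lt_iff₀ hlog] at hs
  obtain ⟨b, hb, hb'⟩ := exists_between (show h < s * Real.log m₁ + δ by linarith)
  set r := b - (s * Real.log m₁ + δ)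
  have hr : r < 0 := by simp only [r]; linarith
  refine summable_of_isBigO_nat (Real.summable_exp_nat_mul_iff.2 hr)
    (Asymptotics.IsBigO.of_bound 1 ?_)
  filter_upwards [hh.eventually (gt_mem_nhds hb), eventually_gt_atTop 0] with n hn hn0
  have hN : (0 : ℝ) < squareCount q Ω n := by exact_mod_cast squareCount_pos hne n
  have hn0' : (0 : ℝ) < n := by exact_mod_cast hn0
  rw [div_lt_iff₀ hn0'] at hn
  have h1 : (((m₁ : ℝ) ^ n)⁻¹) ^ s = Real.exp (-(n * (s * Real.log m₁))) := by
    rw [Real.rpow_def_of_pos (by positivity), Real.log_inv, Real.log_pow]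
    congr 1; ring
  rw [Real.norm_of_nonneg (by positivity), Real.norm_of_nonneg (by positivity), one_mul, h1]
  conv_lhs => rw [← Real.exp_log hN]
  rw [← Real.exp_add, ← Real.exp_add, Real.exp_le_exp]
  simp only [r]
  linarith

/-- For every `N`, the balls of scales `n ≥ N` that meet `X_Ω ∩ B n` cover `X_Ω`. Their `s`-sums are
tails of the series of `summable_squareCount_mul`, so the measure is zero. -/
theorem dimH_multInvSet_le (hm₂ : 2 ≤ m₂) (hm : m₂ < m₁) (hq : 2 ≤ q)
    {Ω : Set (SymSeq m₁ m₂)} (hne : Ω.Nonempty) {h : ℝ}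
    (hh : Tendsto (fun n : ℕ => Real.log (squareCount q Ω n) / n) atTop (𝓝 h)) {δ : ℝ}
    (B : ℕ → Set (SymSeq m₁ m₂)) (hB : ∀ z ∈ multInvSet q Ω, ∃ᶠ n in atTop, z ∈ B n)
    (hcard : ∀ n, ((squareCode q n '' (multInvSet q Ω ∩ B n)).ncard : ℝ) ≤
      squareCount q Ω n * Real.exp (-(δ * n)))
    {s : ℝ≥0} (hs : (h - δ) / Real.log m₁ < s) : dimH (multInvSet q Ω) ≤ s := by
  borelize (SymSeq m₁ m₂)
  have hm1 : (1 : ℝ) < m₁ := by exact_mod_cast (by omega : 1 < m₁)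
  have hsum := summable_squareCount_mul (by omega) hne hh hs
  set a : ℕ → ℝ := fun n =>
    squareCount q Ω n * Real.exp (-(δ * n)) * (((m₁ : ℝ) ^ n)⁻¹) ^ (s : ℝ)
  set Y : ℕ → Set (SymSeq m₁ m₂) := fun n => multInvSet q Ω ∩ B n
  have hdiam : ∀ n (c : blockIdx q (squareHeight m₁ m₂ n) → GenWord m₁ m₂),
      Metric.ediam {z : SymSeq m₁ m₂ | squareCode q n z = c} ≤
        ENNReal.ofReal ((m₁ : ℝ) ^ n)⁻¹ := by
    intro n c
    refine Metric.ediam_le fun z hz w hw => ?_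
    rw [edist_dist]
    exact ENNReal.ofReal_le_ofReal ((squareCode_eq_iff hm₂ hm hq z w n).1 (Eq.trans hz (Eq.symm hw)))
  have hfinY : ∀ n, (squareCode q n '' Y n).Finite := fun n =>
    (finite_squareCode_image hq hne n).subset (image_mono inter_subset_left)
  have hle : MeasureTheory.Measure.hausdorffMeasure (s : ℝ) (multInvSet q Ω) ≤
      liminf (fun N : ℕ => ∑' k : ℕ, ENNReal.ofReal (a (k + N))) atTop := by
    refine (MeasureTheory.Measure.hausdorffMeasure_le_liminf_tsum (s : ℝ) (multInvSet q Ω)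
      (l := atTop) (ι := fun N : ℕ => Σ k : ℕ, (squareCode q (k + N) '' Y (k + N)))
      (fun N => ENNReal.ofReal ((m₁ : ℝ) ^ N)⁻¹) ?_
      (fun N x => {z | squareCode q (x.1 + N) z = x.2}) ?_ ?_).trans ?_
    · rw [← ENNReal.ofReal_zero]
      refine ENNReal.tendsto_ofReal ?_
      exact (tendsto_pow_atTop_atTop_of_one_lt hm1).inv_tendsto_atTop
    · refine Eventually.of_forall fun N x => (hdiam _ _).trans (ENNReal.ofReal_le_ofReal ?_)
      gcongr
      · exact hm1.le
      · exact Nat.le_add_left _ _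
    · refine Eventually.of_forall fun N z hz => ?_
      obtain ⟨n, hn, hzn⟩ := frequently_atTop.1 (hB z hz) N
      obtain ⟨k, rfl⟩ := Nat.exists_eq_add_of_le' hn
      exact mem_iUnion.2 ⟨⟨k, _, z, ⟨hz, hzn⟩, rfl⟩, rfl⟩
    · refine liminf_le_liminf (Eventually.of_forall fun N => ?_)
      rw [ENNReal.tsum_sigma']
      refine ENNReal.tsum_le_tsum fun k => ?_
      have hf := (hfinY (k + N)).to_subtype
      have := Fintype.ofFinite (squareCode q (k + N) '' Y (k + N))
      rw [tsum_fintype]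
      calc ∑ c : (squareCode q (k + N) '' Y (k + N)),
            Metric.ediam {z : SymSeq m₁ m₂ | squareCode q (k + N) z = c} ^ (s : ℝ)
          ≤ ∑ c : (squareCode q (k + N) '' Y (k + N)),
            ENNReal.ofReal ((((m₁ : ℝ) ^ (k + N))⁻¹) ^ (s : ℝ)) := by
            refine Finset.sum_le_sum fun c _ => ?_
            rw [← ENNReal.ofReal_rpow_of_nonneg (by positivity) s.coe_nonneg]
            exact ENNReal.rpow_le_rpow (hdiam _ _) s.coe_nonneg
        _ = ENNReal.ofReal ((squareCode q (k + N) '' Y (k + N)).ncard *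
              (((m₁ : ℝ) ^ (k + N))⁻¹) ^ (s : ℝ)) := by
            rw [Finset.sum_const, nsmul_eq_mul, ENNReal.ofReal_mul (Nat.cast_nonneg _),
              ENNReal.ofReal_natCast, Finset.card_univ, ← Nat.card_eq_fintype_card,
              Nat.card_coe_set_eq]
        _ ≤ ENNReal.ofReal (a (k + N)) := by
            refine ENNReal.ofReal_le_ofReal ?_
            exact mul_le_mul_of_nonneg_right (hcard (k + N)) (by positivity)
  have hlim : Tendsto (fun N : ℕ => ∑' k : ℕ, ENNReal.ofReal (a (k + N))) atTop (𝓝 0) :=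
    ENNReal.tendsto_sum_nat_add _ hsum.tsum_ofReal_ne_top
  rw [hlim.liminf_eq] at hle
  exact dimH_le_of_hausdorffMeasure_ne_top (ne_top_of_le_ne_top ENNReal.zero_ne_top hle)

/-- Markov's inequality: `g` has mean one on each `Pref`, so the product weights of all codes add up
to `squareCount q Ω n`, and each code counted here has weight at least `exp b`. -/
theorem ncard_squareCode_image_le (hq : 2 ≤ q) {Ω : Set (SymSeq m₁ m₂)} (hne : Ω.Nonempty)
    (g : ℕ × ℕ → GenWord m₁ m₂ → ℝ) (hg : ∀ c v, 0 ≤ g c v)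
    (hsum : ∀ c : ℕ × ℕ, ∑ v ∈ (finite_pref Ω c.1 c.2).toFinset, g c v = (pref Ω c.1 c.2).ncard)
    (n : ℕ) (Y : Set (SymSeq m₁ m₂)) {b : ℝ}
    (hY : ∀ z ∈ multInvSet q Ω ∩ Y, Real.exp b ≤ ∏ i ∈ blockIdx q (squareHeight m₁ m₂ n),
      g (blockSize q m₁ m₂ n i)
        ((z.orbit q i).word (blockSize q m₁ m₂ n i).1 (blockSize q m₁ m₂ n i).2)) :
    ((squareCode q n '' (multInvSet q Ω ∩ Y)).ncard : ℝ) ≤ squareCount q Ω n * Real.exp (-b) := by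
  classical
  have hfin : (squareCode q n '' (multInvSet q Ω ∩ Y)).Finite :=
    (finite_squareCode_image hq hne n).subset (image_mono inter_subset_left)
  set I := blockIdx q (squareHeight m₁ m₂ n)
  have hsub : hfin.toFinset ⊆ Fintype.piFinset fun i : I =>
      (finite_pref Ω (blockSize q m₁ m₂ n i).1 (blockSize q m₁ m₂ n i).2).toFinset := by
    rw [← Finset.coe_subset, ← squareCode_image hq hne, Finite.coe_toFinset]
    exact image_mono inter_subset_left
  have h1 : (∏ i : I, ∑ v ∈ (finite_pref Ω (blockSize q m₁ m₂ n i).1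
      (blockSize q m₁ m₂ n i).2).toFinset, g (blockSize q m₁ m₂ n i) v) = squareCount q Ω n := by
    rw [squareCount, Nat.cast_prod, ← Finset.prod_coe_sort (blockIdx q (squareHeight m₁ m₂ n))
      fun i => ((pref Ω (blockSize q m₁ m₂ n i).1 (blockSize q m₁ m₂ n i).2).ncard : ℝ)]
    exact Finset.prod_congr rfl fun i _ => hsum _
  rw [Finset.prod_univ_sum] at h1
  have h2 : (hfin.toFinset.card : ℝ) * Real.exp b ≤ squareCount q Ω n := by
    rw [← h1, ← nsmul_eq_mul]
    refine le_trans (Finset.card_nsmul_le_sum _ _ _ fun v hv => ?_)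
      (Finset.sum_le_sum_of_subset_of_nonneg hsub fun v _ _ =>
        Finset.prod_nonneg fun i _ => hg _ _)
    obtain ⟨z, hz, rfl⟩ := (hfin.mem_toFinset).1 hv
    refine (hY z hz).trans (le_of_eq ?_)
    rw [← Finset.prod_coe_sort]
    rfl
  rw [ncard_eq_toFinset_card _ hfin, Real.exp_neg, ← div_eq_mul_inv, le_div_iff₀ (Real.exp_pos _)]
  exact h2

end UpperBound

/-! ### Logarithmic weights of the scales at which an orbit lies in a class. -/

section Kernel

theorem sum_Ico_inv_mul_succ {a b : ℕ} (ha : 1 ≤ a) (hab : a ≤ b) :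
    ∑ n ∈ Finset.Ico a b, ((n : ℝ) * (n + 1))⁻¹ = (a : ℝ)⁻¹ - (b : ℝ)⁻¹ := by
  induction b, hab using Nat.le_induction with
  | base => simp
  | succ b hab ih =>
    have hb : (b : ℝ) ≠ 0 := Nat.cast_ne_zero.2 (by omega)
    rw [Finset.sum_Ico_succ_top hab, ih]
    push_cast
    field_simp
    ring

/-- The sum of `1 / (n (n + 1))` over the scales `n ≤ T` at which the orbit of `i` has `p` elements
that are at most `n` and `P` elements that are at most the height of the approximate square. -/
noncomputable def classKernel (q m₁ m₂ p P i T : ℕ) : ℝ :=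
  ∑ n ∈ (Finset.Icc 1 T).filter fun n =>
    orbitCount q n i = p ∧ orbitCount q (squareHeight m₁ m₂ n) i = P, ((n : ℝ) * (n + 1))⁻¹

variable {q m₁ m₂ p P : ℕ}

theorem squareHeight_le_iff (hm₂ : 2 ≤ m₂) (hm : m₂ < m₁) {n k : ℕ} :
    squareHeight m₁ m₂ n ≤ k ↔ n < ⌊gammaRatio m₁ m₂ * k⌋₊ + 1 := by
  have h := gammaRatio_pos hm₂ hm
  rw [← not_lt, lt_squareHeight_iff hm₂ hm, not_lt, Nat.lt_succ_iff, Nat.le_floor_iff (by positivity)]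

/-- The first scale of a class. -/
noncomputable def classStart (q m₁ m₂ p P i : ℕ) : ℕ :=
  max (if p = 0 then 1 else i * q ^ (p - 1)) (⌊gammaRatio m₁ m₂ * (i * q ^ (P - 1) - 1 : ℕ)⌋₊ + 1)

/-- The first scale after a class. -/
noncomputable def classEnd (q m₁ m₂ p P i : ℕ) : ℕ :=
  min (i * q ^ p) (⌊gammaRatio m₁ m₂ * (i * q ^ P - 1 : ℕ)⌋₊ + 1)

theorem one_le_classStart (i : ℕ) : 1 ≤ classStart q m₁ m₂ p P i :=
  le_max_of_le_right (Nat.le_add_left _ _)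

/-- For fixed `i` both counts are monotone in `n`, so a class occupies an interval of scales. The
count up to the height is at most `r` exactly when the height is at most `i * q ^ r - 1`, whence the
subtraction in the endpoints. -/
theorem filter_class_eq_Ico (hm₂ : 2 ≤ m₂) (hm : m₂ < m₁) (hq : 2 ≤ q) (hP : 1 ≤ P) {i : ℕ}
    (hi : 1 ≤ i) (T : ℕ) :
    ((Finset.Icc 1 T).filter fun n =>
      orbitCount q n i = p ∧ orbitCount q (squareHeight m₁ m₂ n) i = P) =
      Finset.Ico (classStart q m₁ m₂ p P i) (min (classEnd q m₁ m₂ p P i) (T + 1)) := by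
  have key : ∀ n r, orbitCount q (squareHeight m₁ m₂ n) i ≤ r ↔
      n < ⌊gammaRatio m₁ m₂ * (i * q ^ r - 1 : ℕ)⌋₊ + 1 := fun n r => by
    have : 0 < i * q ^ r := by positivity
    rw [orbitCount_le_iff hq hi, ← squareHeight_le_iff hm₂ hm]
    omega
  obtain ⟨P, rfl⟩ := Nat.exists_eq_add_of_le' hP
  ext n
  have k1 := key n P
  have k2 := key n (P + 1)
  simp only [classStart, classEnd, Finset.mem_filter, Finset.mem_Icc, Finset.mem_Ico, max_le_iff,
    lt_min_iff, Nat.add_sub_cancel]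
  have k3 := orbitCount_le_iff hq hi (x := n) (r := p)
  rcases p with _ | p
  · simp only [if_true]
    omega
  · have k4 := orbitCount_le_iff hq hi (x := n) (r := p)
    have : 0 < i * q ^ p := by positivity
    simp only [Nat.add_sub_cancel, Nat.add_eq_zero_iff, one_ne_zero, and_false, if_false]
    omega

theorem le_mul_classStart (hm₂ : 2 ≤ m₂) (hm : m₂ < m₁) (hq : 2 ≤ q) {i : ℕ} (hi : 1 ≤ i) :
    (i : ℝ) ≤ (1 / gammaRatio m₁ m₂ + 1) * classStart q m₁ m₂ p P i := by
  have hpos : 0 < i * q ^ (P - 1) := by positivity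
  have h : ¬ squareHeight m₁ m₂ (classStart q m₁ m₂ p P i) ≤ i * q ^ (P - 1) - 1 := by
    rw [squareHeight_le_iff hm₂ hm, not_lt]
    exact le_max_right _ _
  have h1 : i ≤ squareHeight m₁ m₂ (classStart q m₁ m₂ p P i) :=
    (Nat.le_mul_of_pos_right i (by positivity : 0 < q ^ (P - 1))).trans (by omega)
  exact (Nat.cast_le.2 h1).trans (squareHeight_le hm₂ hm (one_le_classStart i))

theorem classKernel_nonneg (i T : ℕ) : 0 ≤ classKernel q m₁ m₂ p P i T :=
  Finset.sum_nonneg fun _ _ => by positivity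

/-- The telescoping sum is at most the inverse of the first scale, which is at least a constant
times `i`. -/
theorem classKernel_le (hm₂ : 2 ≤ m₂) (hm : m₂ < m₁) (hq : 2 ≤ q) (hP : 1 ≤ P) {i : ℕ}
    (hi : 1 ≤ i) (T : ℕ) :
    classKernel q m₁ m₂ p P i T ≤ (1 / gammaRatio m₁ m₂ + 1) / i := by
  have hγ := gammaRatio_pos hm₂ hm
  have h0 : (1 : ℝ) ≤ classStart q m₁ m₂ p P i := by exact_mod_cast one_le_classStart i
  have hi0 : (0 : ℝ) < i := by exact_mod_cast hi
  have h1 := le_mul_classStart (p := p) (P := P) hm₂ hm hq hi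
  have h2 : (classStart q m₁ m₂ p P i : ℝ)⁻¹ ≤ (1 / gammaRatio m₁ m₂ + 1) / i := by
    rw [inv_le_comm₀ (by linarith) (by positivity), inv_div, div_le_iff₀' (by positivity)]
    exact h1
  rw [classKernel, filter_class_eq_Ico hm₂ hm hq hP hi]
  rcases le_total (classStart q m₁ m₂ p P i) (min (classEnd q m₁ m₂ p P i) (T + 1)) with h | h
  · rw [sum_Ico_inv_mul_succ (one_le_classStart i) h]
    have : (0 : ℝ) ≤ ((min (classEnd q m₁ m₂ p P i) (T + 1) : ℕ) : ℝ)⁻¹ := by positivity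
    linarith
  · rw [Finset.Ico_eq_empty_of_le h, Finset.sum_empty]
    positivity

theorem tendsto_floor_mul_pow_div (hm₂ : 2 ≤ m₂) (hm : m₂ < m₁) (hq : 2 ≤ q) (r : ℕ) :
    Tendsto (fun i : ℕ => ((⌊gammaRatio m₁ m₂ * (i * q ^ r - 1 : ℕ)⌋₊ + 1 : ℕ) : ℝ) / i) atTop
      (𝓝 (gammaRatio m₁ m₂ * q ^ r)) := by
  have hγ := gammaRatio_pos hm₂ hm
  have h1 : Tendsto (fun i : ℕ => gammaRatio m₁ m₂ * (q : ℝ) ^ r - gammaRatio m₁ m₂ / i) atTop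
      (𝓝 (gammaRatio m₁ m₂ * q ^ r)) := by
    simpa using (tendsto_const_nhds (x := gammaRatio m₁ m₂ * (q : ℝ) ^ r)).sub
      (tendsto_const_div_atTop_nhds_zero_nat (gammaRatio m₁ m₂))
  have h2 : Tendsto (fun i : ℕ => gammaRatio m₁ m₂ * (q : ℝ) ^ r + 1 / i) atTop
      (𝓝 (gammaRatio m₁ m₂ * q ^ r)) := by
    simpa using (tendsto_const_nhds (x := gammaRatio m₁ m₂ * (q : ℝ) ^ r)).add
      (tendsto_const_div_atTop_nhds_zero_nat (1 : ℝ))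
  refine tendsto_of_tendsto_of_tendsto_of_le_of_le' h1 h2 ?_ ?_
  all_goals
    filter_upwards [eventually_ge_atTop 1] with i hi
    have hi0 : (0 : ℝ) < i := by exact_mod_cast hi
    have hpos : 1 ≤ i * q ^ r := Nat.one_le_iff_ne_zero.2 (by positivity)
    have hc : ((i * q ^ r - 1 : ℕ) : ℝ) = i * q ^ r - 1 := by
      rw [Nat.cast_sub hpos]; push_cast; rfl
  · rw [le_div_iff₀ hi0, sub_mul, div_mul_cancel₀ _ hi0.ne']
    have := Nat.lt_floor_add_one (gammaRatio m₁ m₂ * (i * q ^ r - 1 : ℕ))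
    rw [hc] at this ⊢
    push_cast
    linarith
  · rw [div_le_iff₀ hi0, add_mul, div_mul_cancel₀ _ hi0.ne']
    have := Nat.floor_le (a := gammaRatio m₁ m₂ * (i * q ^ r - 1 : ℕ)) (by positivity)
    rw [hc] at this ⊢
    push_cast
    linarith

/-- The scales at which a class is met have positive logarithmic density. -/
def IsPosClass (q m₁ m₂ p P : ℕ) : Prop :=
  1 ≤ P ∧ max (if p = 0 then (0 : ℝ) else (q : ℝ) ^ (p - 1)) (gammaRatio m₁ m₂ * q ^ (P - 1)) <
    min ((q : ℝ) ^ p) (gammaRatio m₁ m₂ * q ^ P)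

/-- The endpoints of the class are asymptotic to `a * i` and `b * i` with `0 < a < b`, so the
telescoping sum is asymptotic to `(a⁻¹ - b⁻¹) / i`. Once `T` has passed the class, it no longer
matters. -/
theorem exists_tendsto_classKernel (hm₂ : 2 ≤ m₂) (hm : m₂ < m₁) (hq : 2 ≤ q)
    (h : IsPosClass q m₁ m₂ p P) :
    ∃ κ > 0, ∃ k : ℕ → ℝ, Tendsto (fun i : ℕ => i * k i) atTop (𝓝 κ) ∧
      ∀ i, 1 ≤ i → ∀ T, i * q ^ p ≤ T → classKernel q m₁ m₂ p P i T = k i := by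
  obtain ⟨hP, h⟩ := h
  have hγ := gammaRatio_pos hm₂ hm
  set a := max (if p = 0 then (0 : ℝ) else (q : ℝ) ^ (p - 1)) (gammaRatio m₁ m₂ * q ^ (P - 1))
  set b := min ((q : ℝ) ^ p) (gammaRatio m₁ m₂ * q ^ P)
  have ha : 0 < a := lt_max_of_lt_right (by positivity)
  have hone : Tendsto (fun i : ℕ => (i : ℝ) / i) atTop (𝓝 1) := by
    refine tendsto_const_nhds.congr' ?_
    filter_upwards [eventually_gt_atTop 0] with n hn
    rw [div_self (by positivity)]
  have hpow : ∀ r : ℕ, Tendsto (fun i : ℕ => ((i * q ^ r : ℕ) : ℝ) / i) atTop (𝓝 ((q : ℝ) ^ r)) := by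
    intro r
    have := hone.mul_const ((q : ℝ) ^ r)
    rw [one_mul] at this
    refine this.congr fun i => ?_
    push_cast
    ring
  have hS : Tendsto (fun i : ℕ => (classStart q m₁ m₂ p P i : ℝ) / i) atTop (𝓝 a) := by
    have h1 : Tendsto (fun i : ℕ => ((if p = 0 then 1 else i * q ^ (p - 1) : ℕ) : ℝ) / i) atTop
        (𝓝 (if p = 0 then (0 : ℝ) else (q : ℝ) ^ (p - 1))) := by
      split_ifs
      · simpa using tendsto_one_div_atTop_nhds_zero_nat (𝕜 := ℝ)
      · exact hpow _
    refine (h1.max (tendsto_floor_mul_pow_div hm₂ hm hq (P - 1))).congr fun i => ?_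
    rw [classStart, Nat.cast_max, max_div_div_right i.cast_nonneg]
  have hE : Tendsto (fun i : ℕ => (classEnd q m₁ m₂ p P i : ℝ) / i) atTop (𝓝 b) := by
    refine ((hpow p).min (tendsto_floor_mul_pow_div hm₂ hm hq P)).congr fun i => ?_
    rw [classEnd, Nat.cast_min, min_div_div_right i.cast_nonneg]
  have hk : ∀ i, 1 ≤ i → ∀ T, i * q ^ p ≤ T → classKernel q m₁ m₂ p P i T =
      ∑ n ∈ Finset.Ico (classStart q m₁ m₂ p P i) (classEnd q m₁ m₂ p P i),
        ((n : ℝ) * (n + 1))⁻¹ := by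
    intro i hi T hT
    rw [classKernel, filter_class_eq_Ico hm₂ hm hq hP hi, min_eq_left]
    exact (min_le_left _ _).trans (hT.trans (Nat.le_succ T))
  refine ⟨a⁻¹ - b⁻¹, sub_pos.2 (inv_strictAnti₀ ha h), _, ?_, hk⟩
  refine ((hS.inv₀ ha.ne').sub (hE.inv₀ (ha.trans h).ne')).congr' ?_
  obtain ⟨d, hd1, hd2⟩ := exists_between h
  filter_upwards [hS.eventually (gt_mem_nhds hd1), hE.eventually (lt_mem_nhds hd2),
    eventually_ge_atTop 1] with i h1 h2 hi
  have hi0 : (0 : ℝ) < i := by exact_mod_cast hi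
  have hle : classStart q m₁ m₂ p P i ≤ classEnd q m₁ m₂ p P i := by
    have := (div_lt_div_iff_of_pos_right hi0).1 (h1.trans h2)
    exact_mod_cast this.le
  rw [sum_Ico_inv_mul_succ (one_le_classStart i) hle, inv_div, inv_div]
  ring

end Kernel

/-! ### From logarithmic averages to infinitely many good scales. -/

section Averaging

/-- The indices `i = m * q + 1` with `m < M` suffice, since `1 / i ≥ 1 / (q * (m + 1))`. -/
theorem log_div_le_sum_blockIdx {q : ℕ} (hq : 2 ≤ q) {M : ℕ} (hM : 1 ≤ M) :
    Real.log M / q ≤ ∑ i ∈ blockIdx q (q * M), (i : ℝ)⁻¹ := by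
  have hinj : InjOn (fun m : ℕ => m * q + 1) (Finset.range M) := by
    intro a _ b _ h
    have h' : a * q = b * q := by simpa using h
    exact Nat.eq_of_mul_eq_mul_right (by omega) h'
  have hsub : (Finset.range M).image (fun m : ℕ => m * q + 1) ⊆ blockIdx q (q * M) := by
    intro i hi
    obtain ⟨m, hm, rfl⟩ := Finset.mem_image.1 hi
    rw [Finset.mem_range] at hm
    rw [mem_blockIdx]
    refine ⟨by omega, ?_, ?_⟩
    · calc m * q + 1 ≤ m * q + q := by omega
        _ = q * (m + 1) := by ring
        _ ≤ q * M := Nat.mul_le_mul_left _ hm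
    · rw [Nat.dvd_add_right (Nat.dvd_mul_left q m), Nat.dvd_one]
      omega
  refine le_trans ?_ (Finset.sum_le_sum_of_subset_of_nonneg hsub fun i _ _ => by positivity)
  rw [Finset.sum_image hinj]
  have h1 : Real.log M ≤ (harmonic M : ℝ) := by
    refine le_trans (Real.log_le_log (by exact_mod_cast hM) ?_) (log_add_one_le_harmonic M)
    push_cast; linarith
  rw [harmonic] at h1
  push_cast at h1
  refine (div_le_div_of_nonneg_right h1 (Nat.cast_nonneg q)).trans ?_
  rw [Finset.sum_div]
  refine Finset.sum_le_sum fun m _ => ?_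
  rw [div_eq_mul_inv, ← mul_inv]
  have : (1 : ℝ) ≤ q := by exact_mod_cast (by omega : 1 ≤ q)
  gcongr
  push_cast
  nlinarith

/-- With `N = q * M` and `T = K * N`, the indices `i ≤ N` give the main term. The losses are bounded
in `M`: there are at most `i₀` small indices, and the `O(N)` indices above `N` contribute at most `C
/ N` each. -/
theorem exists_log_sub_le_sum_blockIdx {q K i₀ : ℕ} (hq : 2 ≤ q) (hK : 1 ≤ K) {L : ℕ → ℕ}
    (hL : ∀ T, T ≤ L T) {c C : ℝ} (hc : 0 ≤ c) (hC : 0 ≤ C) (hLC : ∀ T, 1 ≤ T → L T ≤ C * T)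
    (A : ℕ → ℕ → ℝ) (h₁ : ∀ i, 1 ≤ i → i₀ ≤ i → ∀ T, K * i ≤ T → c / i ≤ A i T)
    (h₂ : ∀ i, 1 ≤ i → ∀ T, |A i T| ≤ C / i) :
    ∃ C', ∀ M : ℕ, 1 ≤ M → c / q * Real.log M - C' ≤
      ∑ i ∈ blockIdx q (L (K * (q * M))), A i (K * (q * M)) := by
  refine ⟨i₀ * (c + C) + C * C * K, fun M hM => ?_⟩
  set N := q * M
  set T := K * N
  have hN : 1 ≤ N := Nat.one_le_iff_ne_zero.2 (by positivity)
  have hN0 : (0 : ℝ) < N := by exact_mod_cast hN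
  have hNT : N ≤ T := Nat.le_mul_of_pos_left _ hK
  have hpt : ∀ i ∈ blockIdx q (L T), (if i ≤ N then c / i else 0) -
      (if i < i₀ then c + C else 0) - C / N ≤ A i T := by
    intro i hi
    have hi1 := (mem_blockIdx.1 hi).1
    have hi0 : (1 : ℝ) ≤ i := by exact_mod_cast hi1
    have h3 := (abs_le.1 (h₂ i hi1 T)).1
    have h4 : C / i ≤ C := div_le_self hC hi0
    have h5 : c / i ≤ c := div_le_self hc hi0
    have h6 : 0 ≤ C / N := by positivity
    split_ifs with h7 h8 h8
    · linarith
    · have := h₁ i hi1 (by omega) T (Nat.mul_le_mul_left _ h7)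
      linarith
    · linarith
    · have : C / i ≤ C / N := by
        have : (N : ℝ) ≤ i := by exact_mod_cast (by omega : N ≤ i)
        gcongr
      linarith
  refine le_trans ?_ (Finset.sum_le_sum hpt)
  rw [Finset.sum_sub_distrib, Finset.sum_sub_distrib]
  have hs1 : c / q * Real.log M ≤ ∑ i ∈ blockIdx q (L T), if i ≤ N then c / i else 0 := by
    have hsub : blockIdx q N ⊆ blockIdx q (L T) := fun i hi => by
      rw [mem_blockIdx] at hi ⊢
      exact ⟨hi.1, hi.2.1.trans (hNT.trans (hL T)), hi.2.2⟩
    refine le_trans ?_ (Finset.sum_le_sum_of_subset_of_nonneg hsub fun i _ _ => by positivity)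
    rw [Finset.sum_congr rfl (g := fun i : ℕ => c * (i : ℝ)⁻¹), ← Finset.mul_sum]
    · rw [div_mul_eq_mul_div, mul_div_assoc]
      exact mul_le_mul_of_nonneg_left (log_div_le_sum_blockIdx hq hM) hc
    · intro i hi
      rw [if_pos (mem_blockIdx.1 hi).2.1, div_eq_mul_inv]
  have hs2 : ∑ i ∈ blockIdx q (L T), (if i < i₀ then c + C else 0) ≤ i₀ * (c + C) := by
    rw [← Finset.sum_filter, Finset.sum_const, nsmul_eq_mul]
    have : ((blockIdx q (L T)).filter fun i => i < i₀) ⊆ Finset.range i₀ := fun i hi => by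
      rw [Finset.mem_filter] at hi
      exact Finset.mem_range.2 hi.2
    have := Finset.card_le_card this
    rw [Finset.card_range] at this
    gcongr
  have hs3 : ∑ i ∈ blockIdx q (L T), C / N ≤ C * C * K := by
    rw [Finset.sum_const, nsmul_eq_mul]
    have h3 : ((blockIdx q (L T)).card : ℝ) ≤ C * T := by
      refine le_trans ?_ (hLC T (hN.trans hNT))
      rw [card_blockIdx]
      exact_mod_cast Nat.sub_le _ _
    calc ((blockIdx q (L T)).card : ℝ) * (C / N) ≤ (C * T) * (C / N) := by gcongr
      _ = C * C * K := by
        simp only [T]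
        push_cast
        field_simp
  linarith

/-- With `δ = c / (2 * q)`, having `G n < δ * n` from some point on would bound the sum by `δ * log
M + O(1)`, against the lower bound `2 * δ * log M - O(1)`. -/
theorem frequently_mul_le_of_log_le_sum {q K : ℕ} (hq : 2 ≤ q) (hK : 1 ≤ K) {c C' : ℝ} (hc : 0 < c)
    (G : ℕ → ℝ) (h : ∀ M : ℕ, 1 ≤ M → c / q * Real.log M - C' ≤
      ∑ n ∈ Finset.Icc 1 (K * (q * M)), ((n : ℝ) * (n + 1))⁻¹ * G n) :
    ∃ᶠ n : ℕ in atTop, c / (2 * q) * n ≤ G n := by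
  intro hcon
  obtain ⟨n₀, hn₀⟩ := eventually_atTop.1 hcon
  have hq0 : (0 : ℝ) < q := by exact_mod_cast (by omega : 0 < q)
  have hK0 : (0 : ℝ) < K := by exact_mod_cast hK
  set δ := c / (2 * q) with hδ
  have hδ0 : 0 < δ := by positivity
  set C₁ := ∑ n ∈ Finset.range n₀, |G n|
  have hub : ∀ M : ℕ, 1 ≤ M → δ * Real.log M ≤ C' + C₁ + δ * (1 + Real.log (K * q)) := by
    intro M hM
    have hM0 : (0 : ℝ) < M := by exact_mod_cast hM
    have h1 := h M hM
    set T := K * (q * M)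
    have hpt : ∀ n ∈ Finset.Icc 1 T, ((n : ℝ) * (n + 1))⁻¹ * G n ≤
        δ * (n : ℝ)⁻¹ + if n < n₀ then |G n| else 0 := by
      intro n hn
      have hn1 : (1 : ℝ) ≤ n := by exact_mod_cast (Finset.mem_Icc.1 hn).1
      have hw : ((n : ℝ) * (n + 1))⁻¹ ≤ 1 := inv_le_one_of_one_le₀ (by nlinarith)
      have hw0 : 0 ≤ ((n : ℝ) * (n + 1))⁻¹ := by positivity
      split_ifs with hlt
      · have h2 : ((n : ℝ) * (n + 1))⁻¹ * G n ≤ |G n| :=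
          (mul_le_mul_of_nonneg_left (le_abs_self _) hw0).trans
            (mul_le_of_le_one_left (abs_nonneg _) hw)
        have : 0 ≤ δ * (n : ℝ)⁻¹ := by positivity
        linarith
      · have h2 := (not_le.1 (hn₀ n (by omega))).le
        have h3 : ((n : ℝ) * (n + 1))⁻¹ * G n ≤ ((n : ℝ) * (n + 1))⁻¹ * (δ * n) :=
          mul_le_mul_of_nonneg_left h2 hw0
        have h4 : ((n : ℝ) * (n + 1))⁻¹ * (δ * n) = δ * ((n : ℝ) + 1)⁻¹ := by
          field_simp
        have h5 : ((n : ℝ) + 1)⁻¹ ≤ (n : ℝ)⁻¹ := by gcongr; linarith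
        have := mul_le_mul_of_nonneg_left h5 hδ0.le
        linarith
    have h2 := h1.trans (Finset.sum_le_sum hpt)
    rw [Finset.sum_add_distrib, ← Finset.mul_sum] at h2
    have h3 : ∑ n ∈ Finset.Icc 1 T, (n : ℝ)⁻¹ ≤ 1 + Real.log T := by
      have := harmonic_le_one_add_log T
      rw [harmonic_eq_sum_Icc] at this
      push_cast at this
      exact this
    have h4 : ∑ n ∈ Finset.Icc 1 T, (if n < n₀ then |G n| else 0) ≤ C₁ := by
      rw [← Finset.sum_filter]
      refine Finset.sum_le_sum_of_subset_of_nonneg (fun n hn => ?_) fun n _ _ => abs_nonneg _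
      exact Finset.mem_range.2 (Finset.mem_filter.1 hn).2
    have h5 : Real.log T = Real.log (K * q) + Real.log M := by
      rw [← Real.log_mul (by positivity) (by positivity)]
      simp only [T]
      push_cast
      rw [mul_assoc]
    have h6 : c / q = 2 * δ := by rw [hδ]; field_simp
    have h7 := mul_le_mul_of_nonneg_left h3 hδ0.le
    rw [h5] at h7
    rw [h6] at h2
    linarith
  have htend : Tendsto (fun M : ℕ => δ * Real.log M) atTop atTop :=
    (Real.tendsto_log_atTop.comp tendsto_natCast_atTop_atTop).const_mul_atTop hδ0
  obtain ⟨M, hM, hM1⟩ := ((htend.eventually_gt_atTop _).and (eventually_ge_atTop 1)).exists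
  exact absurd (hub M hM1) (not_le.2 hM)

variable {q m₁ m₂ : ℕ}

/-- Exchange of summations. Since `P ≥ 1`, indices above the height at `n` have count `0 ≠ P`, so
the range of `i` can be made independent of `n`. -/
theorem sum_Icc_sum_blockIdx (hm₂ : 2 ≤ m₂) (hm : m₂ < m₁) (hq : 2 ≤ q) {p P : ℕ} (hP : 1 ≤ P)
    (g : ℕ → ℝ) (T : ℕ) :
    ∑ n ∈ Finset.Icc 1 T, ((n : ℝ) * (n + 1))⁻¹ * ∑ i ∈ blockIdx q (squareHeight m₁ m₂ n),
      (if orbitCount q n i = p ∧ orbitCount q (squareHeight m₁ m₂ n) i = P then g i else 0) =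
    ∑ i ∈ blockIdx q (squareHeight m₁ m₂ T), g i * classKernel q m₁ m₂ p P i T := by
  have h1 : ∀ n ∈ Finset.Icc 1 T, ∑ i ∈ blockIdx q (squareHeight m₁ m₂ n),
      (if orbitCount q n i = p ∧ orbitCount q (squareHeight m₁ m₂ n) i = P then g i else 0) =
      ∑ i ∈ blockIdx q (squareHeight m₁ m₂ T),
      (if orbitCount q n i = p ∧ orbitCount q (squareHeight m₁ m₂ n) i = P then g i else 0) := by
    intro n hn
    refine Finset.sum_subset (fun i hi => ?_) fun i hi hi' => if_neg fun h => hi' ?_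
    · rw [mem_blockIdx] at hi ⊢
      exact ⟨hi.1, hi.2.1.trans (squareHeight_mono hm₂ hm (Finset.mem_Icc.1 hn).2), hi.2.2⟩
    · rw [mem_blockIdx] at hi ⊢
      have := (lt_orbitCount_iff hq hi.1 (x := squareHeight m₁ m₂ n) (r := 0)).1 (by omega)
      exact ⟨hi.1, by simpa using this, hi.2.2⟩
  rw [Finset.sum_congr rfl fun n hn => by rw [h1 n hn, Finset.mul_sum], Finset.sum_comm]
  refine Finset.sum_congr rfl fun i _ => ?_
  rw [classKernel, Finset.mul_sum, Finset.sum_filter]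
  refine Finset.sum_congr rfl fun n _ => ?_
  split_ifs <;> ring

/-- The order of quantifiers matters: the tilts `g`, `g'` are chosen after `κ`, `κ'`, and `δ` must
serve all points at once, so it precedes `e`. The same label `e i` governs the orbit of `i` in both
classes. -/
theorem exists_frequently_mul_le_sum (hm₂ : 2 ≤ m₂) (hm : m₂ < m₁) (hq : 2 ≤ q) {a b : ℕ × ℕ}
    (ha : IsPosClass q m₁ m₂ a.1 a.2) (hb : IsPosClass q m₁ m₂ b.1 b.2) :
    ∃ κ > 0, ∃ κ' > 0, ∀ g g' : Bool → ℝ, (∀ e, 0 < κ * g e + κ' * g' e) → ∃ δ > 0,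
      ∀ e : ℕ → Bool, ∃ᶠ n : ℕ in atTop, δ * n ≤ ∑ i ∈ blockIdx q (squareHeight m₁ m₂ n),
        ((if orbitCount q n i = a.1 ∧ orbitCount q (squareHeight m₁ m₂ n) i = a.2
          then g (e i) else 0) +
        (if orbitCount q n i = b.1 ∧ orbitCount q (squareHeight m₁ m₂ n) i = b.2
          then g' (e i) else 0)) := by
  obtain ⟨κ, hκ, k, hk, hk'⟩ := exists_tendsto_classKernel hm₂ hm hq ha
  obtain ⟨κ', hκ', l, hl, hl'⟩ := exists_tendsto_classKernel hm₂ hm hq hb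
  refine ⟨κ, hκ, κ', hκ', fun g g' hg => ?_⟩
  have hγ := gammaRatio_pos hm₂ hm
  obtain ⟨c, hc, hcg⟩ : ∃ c > 0, ∀ e, c < κ * g e + κ' * g' e := by
    obtain ⟨c, h1, h2⟩ := exists_between (lt_min (hg true) (hg false))
    refine ⟨c, h1, fun e => ?_⟩
    cases e
    · exact h2.trans_le (min_le_right _ _)
    · exact h2.trans_le (min_le_left _ _)
  have hev : ∀ e, ∀ᶠ i : ℕ in atTop, c < i * (g e * k i + g' e * l i) := by
    intro e
    have h1 : Tendsto (fun i : ℕ => i * (g e * k i + g' e * l i)) atTop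
        (𝓝 (κ * g e + κ' * g' e)) := by
      refine ((hk.mul_const (g e)).add (hl.mul_const (g' e))).congr fun i => ?_
      ring
    exact h1.eventually (lt_mem_nhds (hcg e))
  obtain ⟨i₀, hi₀⟩ := eventually_atTop.1 ((hev true).and (hev false))
  set D := 1 / gammaRatio m₁ m₂ + 1
  set Γ := max (|g true| + |g' true|) (|g false| + |g' false|)
  have hΓ : ∀ e, |g e| + |g' e| ≤ Γ := by
    intro e
    cases e
    · exact le_max_right _ _
    · exact le_max_left _ _
  have hΓ0 : 0 ≤ Γ := (add_nonneg (abs_nonneg _) (abs_nonneg _)).trans (hΓ true)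
  have hD : 0 ≤ D := by positivity
  refine ⟨c / (2 * q), by positivity, fun e => ?_⟩
  have hq0 : 0 < q := by omega
  obtain ⟨C', hC'⟩ := exists_log_sub_le_sum_blockIdx (q := q) (K := q ^ a.1 * q ^ b.1) (i₀ := i₀)
    (c := c) (C := D * (Γ + 1)) (L := squareHeight m₁ m₂) hq
    (Nat.one_le_iff_ne_zero.2 (by positivity)) (le_squareHeight hm₂ hm) hc.le (by positivity)
    (fun T hT => (squareHeight_le hm₂ hm hT).trans (by
      have : D ≤ D * (Γ + 1) := le_mul_of_one_le_right hD (by linarith)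
      gcongr))
    (fun i T => g (e i) * classKernel q m₁ m₂ a.1 a.2 i T +
      g' (e i) * classKernel q m₁ m₂ b.1 b.2 i T)
    (fun i hi hii T hT => by
      have hi0 : (0 : ℝ) < i := by exact_mod_cast hi
      have h1 : i * q ^ a.1 ≤ T := le_trans (by
        rw [mul_comm]
        exact Nat.mul_le_mul_right _ (Nat.le_mul_of_pos_right _ (by positivity))) hT
      have h2 : i * q ^ b.1 ≤ T := le_trans (by
        rw [mul_comm]
        exact Nat.mul_le_mul_right _ (Nat.le_mul_of_pos_left _ (by positivity))) hT
      rw [hk' i hi T h1, hl' i hi T h2, div_le_iff₀' hi0]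
      have h3 := hi₀ i hii
      cases e i
      · exact h3.2.le
      · exact h3.1.le)
    (fun i hi T => by
      have hi0 : (0 : ℝ) < i := by exact_mod_cast hi
      have h1 := classKernel_le (p := a.1) hm₂ hm hq ha.1 hi T
      have h2 := classKernel_le (p := b.1) hm₂ hm hq hb.1 hi T
      have h3 := classKernel_nonneg (q := q) (m₁ := m₁) (m₂ := m₂) (p := a.1) (P := a.2) i T
      have h4 := classKernel_nonneg (q := q) (m₁ := m₁) (m₂ := m₂) (p := b.1) (P := b.2) i T
      refine (abs_add_le _ _).trans ?_
      rw [abs_mul, abs_mul, abs_of_nonneg h3, abs_of_nonneg h4]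
      calc |g (e i)| * classKernel q m₁ m₂ a.1 a.2 i T + |g' (e i)| *
            classKernel q m₁ m₂ b.1 b.2 i T
          ≤ |g (e i)| * (D / i) + |g' (e i)| * (D / i) := by gcongr
        _ = (|g (e i)| + |g' (e i)|) * (D / i) := by ring
        _ ≤ (Γ + 1) * (D / i) := by
            exact mul_le_mul_of_nonneg_right (by linarith [hΓ (e i)]) (by positivity)
        _ = D * (Γ + 1) / i := by ring)
  refine frequently_mul_le_of_log_le_sum hq (K := q ^ a.1 * q ^ b.1)
    (Nat.one_le_iff_ne_zero.2 (by positivity)) hc _ (C' := C') fun M hM => ?_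
  refine (hC' M hM).trans (le_of_eq ?_)
  rw [Finset.sum_add_distrib, ← sum_Icc_sum_blockIdx hm₂ hm hq ha.1 (fun i => g (e i)),
    ← sum_Icc_sum_blockIdx hm₂ hm hq hb.1 (fun i => g' (e i)), ← Finset.sum_add_distrib]
  exact Finset.sum_congr rfl fun n _ => by
    rw [Finset.sum_add_distrib, ← mul_add]

end Averaging

/-! ### Drop of the Hausdorff dimension when a condition fails. -/

section StrictInequality

variable {m₁ m₂ q j : ℕ}

theorem sub_two_mul_sq_le_log_one_add {x : ℝ} (hx : |x| ≤ 1 / 2) :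
    x - 2 * x ^ 2 ≤ Real.log (1 + x) := by
  obtain ⟨h1, -⟩ := abs_le.1 hx
  have h0 : 0 < 1 + x := by linarith
  refine le_trans ?_ (Real.one_sub_inv_le_log_of_pos h0)
  rw [← sub_nonneg]
  have : 1 - (1 + x)⁻¹ - (x - 2 * x ^ 2) = x ^ 2 * (1 + 2 * x) / (1 + x) := by
    field_simp
    ring
  rw [this]
  have : 0 ≤ 1 + 2 * x := by linarith
  positivity

/-- Taking `θ` proportional to `κ'` and `θ'` to `-κ` cancels `x` at first order and leaves `η κ κ' Δ
^ 2 > 0`. With `η = 1 / (4 (κ + κ'))`, the second-order loss is half of this gain. -/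
theorem exists_tilt_pos {κ κ' ρ ρ' : ℝ} (hκ : 0 < κ) (hκ' : 0 < κ') (hρ : ρ ∈ Icc (0 : ℝ) 1)
    (hρ' : ρ' ∈ Icc (0 : ℝ) 1) (hne : ρ ≠ ρ') :
    ∃ θ θ' : ℝ, |θ| ≤ 1 / 2 ∧ |θ'| ≤ 1 / 2 ∧ ∀ x ∈ Icc (0 : ℝ) 1,
      0 < κ * Real.log (1 + θ * (x - ρ)) + κ' * Real.log (1 + θ' * (x - ρ')) := by
  set η := 1 / (4 * (κ + κ')) with hη
  have hη0 : 0 < η := by positivity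
  have hη1 : η * (κ + κ') = 1 / 4 := by rw [hη]; field_simp
  set Δ := ρ' - ρ with hΔ
  have hΔ0 : 0 < Δ ^ 2 := by
    have : Δ ≠ 0 := sub_ne_zero.2 hne.symm
    positivity
  have hΔ1 : |Δ| ≤ 1 := abs_le.2 ⟨by linarith [hρ.2, hρ'.1], by linarith [hρ.1, hρ'.2]⟩
  have hb : ∀ k, 0 < k → k ≤ κ + κ' → |η * Δ * k| ≤ 1 / 2 := by
    intro k hk hk'
    rw [abs_mul, abs_mul, abs_of_pos hη0, abs_of_pos hk]
    calc η * |Δ| * k ≤ η * 1 * (κ + κ') := by gcongr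
      _ ≤ 1 / 2 := by rw [mul_one, hη1]; norm_num
  have h1 := hb κ' hκ' (by linarith)
  have h2 : |-(η * Δ * κ)| ≤ 1 / 2 := by rw [abs_neg]; exact hb κ hκ (by linarith)
  refine ⟨η * Δ * κ', -(η * Δ * κ), h1, h2, fun x hx => ?_⟩
  have key : ∀ θ r : ℝ, |θ| ≤ 1 / 2 → r ∈ Icc (0 : ℝ) 1 →
      θ * (x - r) - 2 * θ ^ 2 ≤ Real.log (1 + θ * (x - r)) := by
    intro θ r hθ hr
    have hxr : |x - r| ≤ 1 := abs_le.2 ⟨by linarith [hr.2, hx.1], by linarith [hr.1, hx.2]⟩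
    have hle : |θ * (x - r)| ≤ 1 / 2 := by
      rw [abs_mul]
      exact (mul_le_of_le_one_right (abs_nonneg _) hxr).trans hθ
    refine le_trans ?_ (sub_two_mul_sq_le_log_one_add hle)
    have : (θ * (x - r)) ^ 2 ≤ θ ^ 2 := by
      rw [mul_pow]
      exact mul_le_of_le_one_right (sq_nonneg _) ((sq_le_one_iff_abs_le_one _).2 hxr)
    linarith
  have k1 := mul_le_mul_of_nonneg_left (key _ ρ h1 hρ) hκ.le
  have k2 := mul_le_mul_of_nonneg_left (key _ ρ' h2 hρ') hκ'.le
  have k3 : κ * (η * Δ * κ' * (x - ρ) - 2 * (η * Δ * κ') ^ 2) +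
      κ' * (-(η * Δ * κ) * (x - ρ') - 2 * (-(η * Δ * κ)) ^ 2) =
      η * κ * κ' * Δ ^ 2 * (1 - 2 * (η * (κ + κ'))) := by
    rw [hΔ]; ring
  rw [hη1] at k3
  have k4 : 0 < η * κ * κ' * Δ ^ 2 * (1 - 2 * (1 / 4)) := by
    have : (0 : ℝ) < 1 - 2 * (1 / 4) := by norm_num
    positivity
  linarith

/-- Both inequalities on `1 / γ` must be strict. If `q ^ j = 1 / γ`, the limiting intervals of the
sizes with `l = j + 1` are empty. -/
theorem isPosClass_of_lt (hm₂ : 2 ≤ m₂) (hm : m₂ < m₁) (hq : 2 ≤ q)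
    (hj : (q : ℝ) ^ j < 1 / gammaRatio m₁ m₂) (hj' : 1 / gammaRatio m₁ m₂ < (q : ℝ) ^ (j + 1))
    {p l : ℕ} (hl : l ≤ j + 1) (hp : 1 ≤ p → j ≤ l) (h : 1 ≤ p + l) :
    IsPosClass q m₁ m₂ p (p + l) := by
  have hγ := gammaRatio_pos hm₂ hm
  have hq1 : (1 : ℝ) < q := by exact_mod_cast (by omega : 1 < q)
  rw [lt_div_iff₀ hγ] at hj
  rw [div_lt_iff₀ hγ] at hj'
  set γ := gammaRatio m₁ m₂
  refine ⟨h, ?_⟩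
  have hstep : ∀ r : ℕ, γ * (q : ℝ) ^ r < γ * (q : ℝ) ^ (r + 1) := fun r => by
    gcongr
    exact r.lt_succ_self
  have hstep' : ∀ r : ℕ, (q : ℝ) ^ r < (q : ℝ) ^ (r + 1) := fun r => by
    gcongr
    exact r.lt_succ_self
  rw [max_lt_iff, lt_min_iff, lt_min_iff]
  rcases p with _ | p
  · obtain ⟨l, rfl⟩ := Nat.exists_eq_add_of_le' (show 1 ≤ l by omega)
    simp only [if_true, zero_add, pow_zero, Nat.add_sub_cancel]
    refine ⟨⟨one_pos, by positivity⟩, ?_, hstep l⟩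
    calc γ * (q : ℝ) ^ l ≤ γ * (q : ℝ) ^ j := by
          gcongr
          · exact hq1.le
          · omega
      _ < 1 := by rwa [mul_comm]
  · have h3 : ∀ r : ℕ, γ * (q : ℝ) ^ (r + j) < (q : ℝ) ^ r := fun r => by
      have : (0 : ℝ) < (q : ℝ) ^ r := by positivity
      calc γ * (q : ℝ) ^ (r + j) = (q : ℝ) ^ r * ((q : ℝ) ^ j * γ) := by rw [pow_add]; ring
        _ < (q : ℝ) ^ r := mul_lt_of_lt_one_right this hj
    have h4 : ∀ r : ℕ, (q : ℝ) ^ r < γ * (q : ℝ) ^ (r + (j + 1)) := fun r => by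
      have : (0 : ℝ) < (q : ℝ) ^ r := by positivity
      calc (q : ℝ) ^ r < (q : ℝ) ^ r * ((q : ℝ) ^ (j + 1) * γ) := lt_mul_of_one_lt_right this hj'
        _ = _ := by rw [pow_add _ r]; ring
    rw [if_neg (by omega), Nat.add_sub_cancel]
    rcases (show l = j ∨ l = j + 1 by have := hp (by omega); omega) with rfl | rfl
    · have e1 : p + 1 + l = p + (l + 1) := by ring
      have e2 : p + (l + 1) - 1 = p + l := by omega
      rw [e1, e2]
      exact ⟨⟨hstep' p, h4 p⟩, (h3 p).trans (hstep' p), hstep (p + l)⟩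
    · have e1 : p + 1 + (j + 1) = p + (j + 1) + 1 := by ring
      have e2 : p + (j + 1) + 1 - 1 = p + 1 + j := by omega
      rw [e1, e2]
      refine ⟨⟨hstep' p, (h4 p).trans (hstep _)⟩, h3 (p + 1), ?_⟩
      have := hstep (p + (j + 1))
      rwa [show p + (j + 1) = p + 1 + j by ring] at this ⊢

theorem blockSize_eq_iff (hm₂ : 2 ≤ m₂) (hm : m₂ < m₁) {n i : ℕ} {c : ℕ × ℕ} :
    blockSize q m₁ m₂ n i = c ↔ orbitCount q n i = c.1 ∧
      orbitCount q (squareHeight m₁ m₂ n) i = c.1 + c.2 := by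
  have := orbitCount_mono (q := q) (le_squareHeight hm₂ hm n) i
  rw [blockSize, Prod.ext_iff]
  simp only
  omega

theorem dimH_lt_of_not_uniformlyRefines (hm₂ : 2 ≤ m₂) (hm : m₂ < m₁) (hq : 2 ≤ q)
    {Ω : Set (SymSeq m₁ m₂)} (hne : Ω.Nonempty) {h : ℝ}
    (hh : Tendsto (fun n : ℕ => Real.log (squareCount q Ω n) / n) atTop (𝓝 h)) {a b : ℕ × ℕ}
    (ha : IsPosClass q m₁ m₂ a.1 (a.1 + a.2)) (hb : IsPosClass q m₁ m₂ b.1 (b.1 + b.2))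
    (hab : a.1 ≤ b.1) (hab' : a.1 + a.2 ≤ b.1 + b.2)
    (hU : ¬ UniformlyRefines Ω (word a.1 a.2) (word b.1 b.2)) :
    dimH (multInvSet q Ω) < ENNReal.ofReal (h / Real.log m₁) := by
  classical
  obtain ⟨s, hs, hs'⟩ : ∃ s ∈ Ω, (word b.1 b.2 '' {t ∈ Ω | t.word a.1 a.2 = s.word a.1 a.2}).ncard *
      (word a.1 a.2 '' Ω).ncard ≠ (word b.1 b.2 '' Ω).ncard := by
    by_contra! hcon
    exact hU (uniformlyRefines_of_ncard_mul (finite_image_word _ _ _) hcon)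
  -- The words of size `c` of the elements of `Ω` that share the word of size `a` of `s`; `ρ c` is
  -- their proportion. The choice of `s` gives `ρ a ≠ ρ b`.
  let V : ℕ × ℕ → Set (GenWord m₁ m₂) := fun c =>
    word c.1 c.2 '' {t ∈ Ω | t.word a.1 a.2 = s.word a.1 a.2}
  have hVsub : ∀ c, V c ⊆ pref Ω c.1 c.2 := fun c => by
    rw [pref_eq_image]
    exact image_mono fun t ht => ht.1
  let ρ : ℕ × ℕ → ℝ := fun c => (V c).ncard / (pref Ω c.1 c.2).ncard
  have hpref : ∀ c : ℕ × ℕ, (0 : ℝ) < (pref Ω c.1 c.2).ncard := fun c => by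
    exact_mod_cast ncard_pref_pos hne _ _
  have hρ : ∀ c, ρ c ∈ Icc (0 : ℝ) 1 := fun c => ⟨by positivity, by
    rw [div_le_one (hpref c)]
    exact_mod_cast ncard_le_ncard (hVsub c) (finite_pref _ _ _)⟩
  have hmemV : ∀ c : ℕ × ℕ, a.1 ≤ c.1 → a.1 + a.2 ≤ c.1 + c.2 → ∀ t ∈ Ω,
      (t.word c.1 c.2 ∈ V c ↔ t.word a.1 a.2 = s.word a.1 a.2) := by
    intro c hc hc' t ht
    constructor
    · rintro ⟨t', ht', htt⟩
      rw [← ht'.2]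
      exact (word_factorsThrough hc hc' htt).symm
    · exact fun h => ⟨t, ⟨ht, h⟩, rfl⟩
  have hρab : ρ a ≠ ρ b := by
    intro heq
    have hVa : (V a).ncard = 1 := by
      rw [ncard_eq_one]
      refine ⟨s.word a.1 a.2, ?_⟩
      ext u
      constructor
      · rintro ⟨t, ht, rfl⟩; exact ht.2
      · rintro rfl; exact ⟨s, ⟨hs, rfl⟩, rfl⟩
    simp only [ρ, hVa] at heq
    rw [div_eq_div_iff (hpref a).ne' (hpref b).ne', Nat.cast_one, one_mul] at heq
    rw [← pref_eq_image Ω, ← pref_eq_image Ω] at hs'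
    exact hs' (by exact_mod_cast heq.symm)
  have hne_ab : a ≠ b := fun h => hρab (by rw [h])
  obtain ⟨κ, hκ, κ', hκ', hfreq⟩ := exists_frequently_mul_le_sum hm₂ hm hq
    (a := (a.1, a.1 + a.2)) (b := (b.1, b.1 + b.2)) ha hb
  obtain ⟨θ, θ', hθ, hθ', hpos⟩ := exists_tilt_pos hκ hκ' (hρ a) (hρ b) hρab
  obtain ⟨δ, hδ, hfreq⟩ := hfreq
    (fun e => Real.log (1 + θ * ((if e then 1 else 0) - ρ a)))
    (fun e => Real.log (1 + θ' * ((if e then 1 else 0) - ρ b)))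
    (fun e => hpos _ (by cases e <;> simp))
  let Θ : ℕ × ℕ → ℝ := fun c => if c = a then θ else if c = b then θ' else 0
  have hΘ : ∀ c, |Θ c| ≤ 1 / 2 := fun c => by
    simp only [Θ]
    split_ifs
    · exact hθ
    · exact hθ'
    · norm_num
  -- Subtracting `ρ c` gives mean one on `Pref`. Sizes other than `a` and `b` are not tilted.
  let g : ℕ × ℕ → GenWord m₁ m₂ → ℝ := fun c v => 1 + Θ c * ((if v ∈ V c then 1 else 0) - ρ c)
  have hg : ∀ c v, 0 < g c v := by
    intro c v
    have h1 : |(if v ∈ V c then (1 : ℝ) else 0) - ρ c| ≤ 1 := by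
      have := hρ c
      split_ifs
      · exact abs_le.2 ⟨by linarith [this.2], by linarith [this.1]⟩
      · exact abs_le.2 ⟨by linarith [this.2], by linarith [this.1]⟩
    have h2 : |Θ c * ((if v ∈ V c then (1 : ℝ) else 0) - ρ c)| ≤ 1 / 2 := by
      rw [abs_mul]
      exact (mul_le_of_le_one_right (abs_nonneg _) h1).trans (hΘ c)
    have := (abs_le.1 h2).1
    simp only [g]
    linarith
  have hsum : ∀ c : ℕ × ℕ, ∑ v ∈ (finite_pref Ω c.1 c.2).toFinset, g c v =
      (pref Ω c.1 c.2).ncard := by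
    intro c
    have h1 : ((finite_pref Ω c.1 c.2).toFinset.card : ℝ) = (pref Ω c.1 c.2).ncard := by
      rw [ncard_eq_toFinset_card _ (finite_pref Ω c.1 c.2)]
    have h2 : ∑ v ∈ (finite_pref Ω c.1 c.2).toFinset, (if v ∈ V c then (1 : ℝ) else 0) =
        (V c).ncard := by
      rw [Finset.sum_boole, ← ncard_coe_finset]
      congr 2
      ext v
      simp only [Finset.coe_filter, Finite.mem_toFinset, mem_ofPred_eq]
      exact ⟨fun h => h.2, fun h => ⟨hVsub c h, h⟩⟩
    simp only [g]
    rw [Finset.sum_add_distrib, ← Finset.mul_sum, Finset.sum_sub_distrib, h2, Finset.sum_const,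
      Finset.sum_const, nsmul_eq_mul, nsmul_eq_mul, h1]
    simp only [ρ]
    rw [mul_div_cancel₀ _ (hpref c).ne']
    ring
  let B : ℕ → Set (SymSeq m₁ m₂) := fun n => {z | Real.exp (δ * n) ≤
    ∏ i ∈ blockIdx q (squareHeight m₁ m₂ n), g (blockSize q m₁ m₂ n i)
      ((z.orbit q i).word (blockSize q m₁ m₂ n i).1 (blockSize q m₁ m₂ n i).2)}
  have hcard : ∀ n, ((squareCode q n '' (multInvSet q Ω ∩ B n)).ncard : ℝ) ≤
      squareCount q Ω n * Real.exp (-(δ * n)) := fun n =>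
    ncard_squareCode_image_le hq hne g (fun c v => (hg c v).le) hsum n (B n) fun z hz => hz.2
  have hB : ∀ z ∈ multInvSet q Ω, ∃ᶠ n in atTop, z ∈ B n := by
    intro z hz
    -- Membership in `V` is decided by the word of size `a` for both sizes, so one label per orbit
    -- is enough.
    refine (hfreq fun i => decide ((z.orbit q i).word a.1 a.2 = s.word a.1 a.2)).mono fun n hn => ?_
    change Real.exp (δ * n) ≤ _
    rw [← Real.le_log_iff_exp_le (Finset.prod_pos fun i _ => hg _ _),
      Real.log_prod fun i _ => (hg _ _).ne']
    refine hn.trans (le_of_eq (Finset.sum_congr rfl fun i hi => ?_))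
    have hzi := mem_multInvSet_iff.1 hz i (mem_blockIdx.1 hi).2.2
    simp only [← blockSize_eq_iff hm₂ hm (c := a), ← blockSize_eq_iff hm₂ hm (c := b)]
    set c := blockSize q m₁ m₂ n i
    by_cases hca : c = a
    · rw [if_pos hca, if_neg (fun h => hne_ab (hca.symm.trans h)), add_zero, hca]
      simp only [g, Θ, if_true, hmemV a le_rfl le_rfl _ hzi, decide_eq_true_eq]
    · by_cases hcb : c = b
      · rw [if_neg hca, if_pos hcb, zero_add, hcb]
        simp only [g, Θ, if_neg hne_ab.symm, if_true, hmemV b hab hab' _ hzi, decide_eq_true_eq]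
      · rw [if_neg hca, if_neg hcb]
        simp [g, Θ, if_neg hca, if_neg hcb]
  -- At a large scale with `z ∈ B n`, at least one ball is counted, so `exp (δ n) ≤ squareCount q Ω
  -- n`. This keeps the new exponent nonnegative.
  have hδh : δ ≤ h := by
    by_contra! hlt
    obtain ⟨z, hz⟩ : (multInvSet q Ω).Nonempty := by
      obtain ⟨z, hz, -⟩ := exists_mem_multInvSet_orbit_eq hq hne (N := 0) (fun _ => hne.some)
        fun _ => hne.some_mem
      exact ⟨z, hz⟩
    obtain ⟨n, hzn, hn, hn0⟩ := ((hB z hz).and_eventually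
      ((hh.eventually (gt_mem_nhds hlt)).and (eventually_gt_atTop 0))).exists
    have hN : (0 : ℝ) < squareCount q Ω n := by exact_mod_cast squareCount_pos hne n
    have h1 : (1 : ℝ) ≤ (squareCode q n '' (multInvSet q Ω ∩ B n)).ncard := by
      have := (ncard_pos ((finite_squareCode_image hq hne n).subset
        (image_mono inter_subset_left))).2 (⟨_, z, ⟨hz, hzn⟩, rfl⟩ :
          (squareCode q n '' (multInvSet q Ω ∩ B n)).Nonempty)
      exact_mod_cast this
    have h2 := h1.trans (hcard n)
    rw [Real.exp_neg, ← div_eq_mul_inv, one_le_div (Real.exp_pos _), ← Real.le_log_iff_exp_le hN]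
      at h2
    rw [div_lt_iff₀ (by exact_mod_cast hn0)] at hn
    linarith
  have hlog : 0 < Real.log m₁ := Real.log_pos (by exact_mod_cast (by omega : 1 < m₁))
  have hlt : (h - δ) / Real.log m₁ < h / Real.log m₁ := by
    gcongr
    linarith
  obtain ⟨r, hr1, hr2⟩ := exists_between hlt
  have hr0 : 0 ≤ r := le_trans (div_nonneg (by linarith) hlog.le) hr1.le
  refine lt_of_le_of_lt (dimH_multInvSet_le hm₂ hm hq hne hh B hB hcard (s := r.toNNReal)
    (by rwa [Real.coe_toNNReal _ hr0])) ?_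
  exact (ENNReal.ofReal_lt_ofReal_iff (hr0.trans_lt hr2)).2 hr2

/-- Each condition is a uniform refinement between two nested sizes that are classes of positive
density, so a failure of any of them triggers the drop. -/
theorem dimH_multInvSet_lt (hm₂ : 2 ≤ m₂) (hm : m₂ < m₁) (hq : 2 ≤ q)
    (hj : (q : ℝ) ^ j < 1 / gammaRatio m₁ m₂) (hj' : 1 / gammaRatio m₁ m₂ < (q : ℝ) ^ (j + 1))
    {Ω : Set (SymSeq m₁ m₂)} (hne : Ω.Nonempty) {h : ℝ}
    (hh : Tendsto (fun n : ℕ => Real.log (squareCount q Ω n) / n) atTop (𝓝 h))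
    (hU : ¬ HasUniformFollowers Ω j) :
    dimH (multInvSet q Ω) < ENNReal.ofReal (h / Real.log m₁) := by
  by_contra hlt
  have key : ∀ p l p' l', l ≤ j + 1 → (1 ≤ p → j ≤ l) → 1 ≤ p + l → l' ≤ j + 1 →
      (1 ≤ p' → j ≤ l') → p ≤ p' → p + l ≤ p' + l' →
      UniformlyRefines Ω (word p l) (word p' l') := by
    intro p l p' l' h1 h2 h3 h4 h5 h6 h7
    by_contra hcon
    exact hlt (dimH_lt_of_not_uniformlyRefines hm₂ hm hq hne hh (a := (p, l)) (b := (p', l'))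
      (isPosClass_of_lt hm₂ hm hq hj hj' h1 h2 h3)
      (isPosClass_of_lt hm₂ hm hq hj hj' h4 h5 (by omega)) h6 h7 hcon)
  refine hU (hasUniformFollowers_iff.2 ⟨fun k hk => ?_, fun p hp hp' => ?_, fun p => ?_⟩)
  all_goals apply key <;> omega

end StrictInequality

/-! ### Conclusion. -/

theorem mainTheorem7 (m₁ m₂ q j : ℕ) (hm₂ : 2 ≤ m₂) (hm : m₂ < m₁) (hq : 2 ≤ q)
    (hj : (q : ℝ) ^ j ≤ 1 / gammaRatio m₁ m₂) (hj' : 1 / gammaRatio m₁ m₂ < (q : ℝ) ^ (j + 1))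
    (Ω : Set (SymSeq m₁ m₂)) (hΩ : IsClosed Ω) (hne : Ω.Nonempty) :
    ∃ D : ℝ≥0, HasMinkowskiDim (multInvSet q Ω) D ∧
      (HasUniformFollowers Ω j → (D : ℝ≥0∞) = dimH (multInvSet q Ω)) ∧
      ((q : ℝ) ^ j ≠ 1 / gammaRatio m₁ m₂ →
        ((D : ℝ≥0∞) = dimH (multInvSet q Ω) ↔ HasUniformFollowers Ω j)) := by
  obtain ⟨h, hh⟩ := exists_tendsto_log_squareCount hm₂ hm hq hne
  have hlog : 0 < Real.log m₁ := Real.log_pos (by exact_mod_cast (by omega : 1 < m₁))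
  have h0 : 0 ≤ h := by
    refine ge_of_tendsto' hh fun n => ?_
    have : (1 : ℝ) ≤ squareCount q Ω n := by exact_mod_cast squareCount_pos hne n
    exact div_nonneg (Real.log_nonneg this) n.cast_nonneg
  have hD : 0 ≤ h / Real.log m₁ := by positivity
  have heq : HasUniformFollowers Ω j →
      ENNReal.ofReal (h / Real.log m₁) = dimH (multInvSet q Ω) := by
    intro hU
    apply le_antisymm
    · refine ENNReal.le_of_forall_nnreal_lt fun r hr => ?_
      rcases eq_or_ne r 0 with rfl | hr0
      · simp
      · exact le_dimH_multInvSet hm₂ hm hq hj hj' hΩ hne hU hh (pos_iff_ne_zero.2 hr0)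
          (by
          rwa [← ENNReal.ofReal_coe_nnreal, ENNReal.ofReal_lt_ofReal_iff_of_nonneg r.coe_nonneg]
            at hr)
    · refine ENNReal.le_of_forall_pos_le_add fun ε hε _ => ?_
      rw [ENNReal.ofReal, ← ENNReal.coe_add]
      -- With no gain and `B n` everything, this is the general bound of the Hausdorff by the
      -- Minkowski dimension.
      refine dimH_multInvSet_le hm₂ hm hq hne hh (δ := 0) (fun _ => univ)
        (fun z _ => Frequently.of_forall fun _ => mem_univ z) (fun n => ?_) ?_
      · rw [inter_univ, ncard_squareCode_image hq hne]
        simp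
      · rw [sub_zero, NNReal.coe_add, Real.coe_toNNReal _ hD]
        exact lt_add_of_pos_right _ (NNReal.coe_pos.2 hε)
  refine ⟨(h / Real.log m₁).toNNReal, ?_, heq,
    fun hjne => ⟨fun hDim => ?_, heq⟩⟩
  · rw [Real.coe_toNNReal _ hD]
    exact hasMinkowskiDim_multInvSet hm₂ hm hq hΩ hne hh
  by_contra hU
  have hlt := dimH_multInvSet_lt hm₂ hm hq (lt_of_le_of_ne hj hjne) hj' hne hh hU
  exact hlt.ne hDim.symm
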